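/- Let $d,h\in\mathbb N$, $1/2<\alpha\le 1$ and $C_\alpha\in(0,\infty)$. Vectors carry the maximum norm $|\cdot|$, and $\|u\|_\infty=\sup_{0\le t\le 1}|u(t)|$. Let $x:[0,1]\to\mathbb R^h$ satisfy $|x(t)-x(s)|\le C_\alpha|t-s|^\alpha$ for all $s,t\in[0,1]$. Let $f=[f_{ij}]:\mathbb R^d\to\mathbb R^{d\times h}$ be non-constant and of class $C^2$, with $$|f|=\sup_{z}\max_{i,j}|f_{ij}(z)|,\qquad |\nabla f|=\sup_z\max_{i,j,k}|\partial_kf_{ij}(z)|,\qquad |\nabla^2f|=\sup_z\max_{i,j,k,l}|\partial_l\partial_kf_{ij}(z)|$$ all finite. Let $y:[0,1]\to\mathbb R^d$ be a solution of $dy=f(y)\,dx$, $y(0)=y_0$, that is, $$y^i(t)=y^i_0+\sum_{j=1}^h\int_0^tf_{ij}(y(s))\,dx^j(s)\qquad\text{for all } t\in[0,1],\ 1\le i\le d,$$ where the integrals are Young integrals: $\int_a^b v\,du$ is defined for continuous $u,v$ of finite $p$- and $q$-variation on $[a,b]$ for some $p,q\ge 1$ with $1/p+1/q>1$, as the limit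 of $\sum_i v(t_i)(u(t_{i+1})-u(t_i))$ as the mesh of the partition $(t_i)$ of $[a,b]$ tends to $0$. For $n\ge 0$ put $\Delta_n=2^{-n}$ and $t^n_k=k2^{-n}$, and let $y_n$ be given by the Euler scheme $$y_n(0)=y_0,\qquad y_n(t^n_{k+1})=y_n(t^n_k)+f(y_n(t^n_k))\,(x(t^n_{k+1})-x(t^n_k)),\quad 0\le k<2^n,$$ extended by $y_n(t)=y_n(t^n_k)$ for $t\in[t^n_k,t^n_{k+1})$. Then for every $n\ge 0$ $$\|y_n-y\|_\infty\le G\,\Delta_n^{2\alpha-1},\qquad G=\Upsilon_{\lceil(4\zeta)^{1/\alpha}\rceil}+G_1^*,$$ where, with $K(\theta)=1+\sum_{m\ge1}m^{-\theta}$, $$G_1^*=2h\,\bigl\lceil(2dhC_\alpha K(2\alpha)|\nabla f|)^{1/\alpha}\bigr\rceil^{1-\alpha}|f|\,C_\alpha,\qquad G_2^*=dh\,K(2\alpha)\,|\nabla f|\,C_\alpha\,G_1^*,$$ $$L=\frac{4}{1-2^{1-2\alpha}}(hC_\alpha)^2|\nabla f|\,|f|,\qquad \omega=\Bigl(\frac{h|f|C_\alpha}{L}\Bigr)^{1/\alpha},\qquad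 G_1=(L+h|f|C_\alpha)(1+\omega^{-1}),$$ $$\zeta=h\,K(2\alpha)\,C_\alpha\bigl(d|\nabla f|+d^2|\nabla^2f|(G_1^*+G_1)\bigr),\qquad \upsilon=C_\alpha\bigl(d^2h\,K(2\alpha)\,|\nabla^2f|(G_1^*+G_1)+d|\nabla f|\bigr),$$ $$\Upsilon_1=(4\zeta)^{-1}\cdot 2G_2^*,\qquad \Upsilon_k=(4\zeta)^{-1}\cdot 2(G_2^*+\upsilon\Upsilon_{k-1})+\Upsilon_{k-1}\quad(k\ge2).$$ -/

import Mathlib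

namespace YoungEuler

noncomputable section

/-- `t 0 ≤ t 1 ≤ ⋯ ≤ t N` is a finite partition of `[a, b]`
(the values of `t` beyond the index `N` play no role). -/
def IsPartition (t : ℕ → ℝ) (N : ℕ) (a b : ℝ) : Prop :=
  Monotone t ∧ t 0 = a ∧ t N = b

/-- The path `u` has finite `p`-variation on `[a, b]`. -/
def HasFinitePVariation (p : ℝ) (u : ℝ → ℝ) (a b : ℝ) : Prop :=
  ∃ M : ℝ, ∀ (N : ℕ) (t : ℕ → ℝ), IsPartition t N a b →
    ∑ i ∈ Finset.range N, |u (t (i + 1)) - u (t i)| ^ p ≤ M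

/-- The left-point Riemann sums of `v` against `u` over the partitions of `[a, b]` converge to `I`
as the mesh goes to zero. -/
def RiemannSumsTendTo (v u : ℝ → ℝ) (a b I : ℝ) : Prop :=
  ∀ ε > 0, ∃ δ > 0, ∀ (N : ℕ) (t : ℕ → ℝ), IsPartition t N a b →
    (∀ i < N, t (i + 1) - t i < δ) →
      |∑ i ∈ Finset.range N, v (t i) * (u (t (i + 1)) - u (t i)) - I| < ε

/-- The Young integral `∫_a^b v du` is defined and equals `I`: the paths `u` and `v` are continuous
on `[a, b]`, of finite `p`- and `q`-variation with `1/p + 1/q > 1`, and `I` is the limit of the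
Riemann sums. -/
def IsYoungIntegral (v u : ℝ → ℝ) (a b I : ℝ) : Prop :=
  ContinuousOn u (Set.Icc a b) ∧ ContinuousOn v (Set.Icc a b) ∧
  (∃ p q : ℝ, 1 ≤ p ∧ 1 ≤ q ∧ 1 < 1 / p + 1 / q ∧
    HasFinitePVariation p u a b ∧ HasFinitePVariation q v a b) ∧
  RiemannSumsTendTo v u a b I

variable {d h : ℕ}

/-- `y` solves `y(t) = y₀ + ∫_0^t f(y(s)) dx(s)` for all `t ∈ [0, 1]`, the integrals of the entries
being Young integrals. -/
def IsYoungSolution (f : (Fin d → ℝ) → Matrix (Fin d) (Fin h) ℝ) (x : ℝ → Fin h → ℝ)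
    (y₀ : Fin d → ℝ) (y : ℝ → Fin d → ℝ) : Prop :=
  ∀ t ∈ Set.Icc (0 : ℝ) 1, ∃ J : Matrix (Fin d) (Fin h) ℝ,
    (∀ i j, IsYoungIntegral (fun s => f (y s) i j) (fun s => x s j) 0 t (J i j)) ∧
    ∀ i, y t i = y₀ i + ∑ j, J i j

/-- The partial derivative `∂g/∂z_k` at `z`. -/
def partialDeriv (k : Fin d) (g : (Fin d → ℝ) → ℝ) (z : Fin d → ℝ) : ℝ :=
  fderiv ℝ g z (Pi.single k 1)

/-- `|f|`: the supremum over `z` of the largest absolute value of an entry of `f z`. -/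
def supAbs (f : (Fin d → ℝ) → Matrix (Fin d) (Fin h) ℝ) : ℝ :=
  ⨆ q : (Fin d → ℝ) × Fin d × Fin h, |f q.1 q.2.1 q.2.2|

/-- `|∇f|`: the supremum of the absolute values of all first partial derivatives of all entries. -/
def supGrad (f : (Fin d → ℝ) → Matrix (Fin d) (Fin h) ℝ) : ℝ :=
  ⨆ q : (Fin d → ℝ) × Fin d × Fin h × Fin d,
    |partialDeriv q.2.2.2 (fun z => f z q.2.1 q.2.2.1) q.1|

/-- `|∇²f|`: the supremum of the absolute values of all second partial derivatives of all
entries. -/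
def supHess (f : (Fin d → ℝ) → Matrix (Fin d) (Fin h) ℝ) : ℝ :=
  ⨆ q : (Fin d → ℝ) × Fin d × Fin h × Fin d × Fin d,
    |partialDeriv q.2.2.2.2 (partialDeriv q.2.2.2.1 (fun z => f z q.2.1 q.2.2.1)) q.1|

/-- `f` is of class `C²`, and its entries are bounded together with their first and second partial
derivatives. -/
structure IsC2Bounded (f : (Fin d → ℝ) → Matrix (Fin d) (Fin h) ℝ) : Prop where
  contDiff : ∀ i j, ContDiff ℝ 2 (fun z => f z i j)
  bounded : ∃ M : ℝ, ∀ i j z, |f z i j| ≤ M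
  bounded_grad : ∃ M : ℝ, ∀ i j k z, |partialDeriv k (fun w => f w i j) z| ≤ M
  bounded_hess : ∃ M : ℝ, ∀ i j k l z,
    |partialDeriv l (partialDeriv k (fun w => f w i j)) z| ≤ M

/-- The Euler scheme at the grid points: `eulerGrid f x y₀ n k = y_n(k / 2^n)`. -/
def eulerGrid (f : (Fin d → ℝ) → Matrix (Fin d) (Fin h) ℝ) (x : ℝ → Fin h → ℝ)
    (y₀ : Fin d → ℝ) (n : ℕ) : ℕ → Fin d → ℝ
  | 0 => y₀
  | k + 1 => eulerGrid f x y₀ n k +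
      (f (eulerGrid f x y₀ n k)).mulVec (x (((k + 1 : ℕ) : ℝ) / 2 ^ n) - x ((k : ℝ) / 2 ^ n))

/-- The piecewise constant extension: the value at `t` is that of the scheme at `k / 2^n`, where
`k / 2^n ≤ t < (k + 1) / 2^n`. -/
def eulerPath (f : (Fin d → ℝ) → Matrix (Fin d) (Fin h) ℝ) (x : ℝ → Fin h → ℝ)
    (y₀ : Fin d → ℝ) (n : ℕ) (t : ℝ) : Fin d → ℝ :=
  eulerGrid f x y₀ n ⌊t * 2 ^ n⌋₊

/-! The explicit constants. Below, `d` and `h` are the dimensions, `α` is the Hölder exponent,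
`C` is the Hölder constant of `x`, and `F`, `D`, `S` stand for `|f|`, `|∇f|`, `|∇²f|`. -/

/-- `K(θ) = 1 + ∑_{n ≥ 1} n^{-θ}`. -/
def constK (θ : ℝ) : ℝ := 1 + ∑' n : ℕ, ((n : ℝ) + 1) ^ (-θ)

/-- `G*_1`. -/
def constG1star (d h : ℕ) (α C F D : ℝ) : ℝ :=
  2 * h * (⌈(2 * d * h * C * constK (2 * α) * D) ^ (1 / α)⌉₊ : ℝ) ^ (1 - α) * F * C

/-- `G*_2`. -/
def constG2star (d h : ℕ) (α C F D : ℝ) : ℝ :=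
  d * h * constK (2 * α) * D * C * constG1star d h α C F D

/-- `L`. -/
def constL (h : ℕ) (α C F D : ℝ) : ℝ :=
  4 / (1 - (2 : ℝ) ^ (1 - 2 * α)) * (h * C) ^ 2 * D * F

/-- `ω`. -/
def constOmega (h : ℕ) (α C F D : ℝ) : ℝ :=
  (h * F * C / constL h α C F D) ^ (1 / α)

/-- `G_1`. -/
def constG1 (h : ℕ) (α C F D : ℝ) : ℝ :=
  (constL h α C F D + h * F * C) * (1 + (constOmega h α C F D)⁻¹)

/-- `ζ`. -/
def constZeta (d h : ℕ) (α C F D S : ℝ) : ℝ :=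
  h * constK (2 * α) * C *
    (d * D + d ^ 2 * S * (constG1star d h α C F D + constG1 h α C F D))

/-- `υ`. -/
def constUpsilon (d h : ℕ) (α C F D S : ℝ) : ℝ :=
  C * (d ^ 2 * h * constK (2 * α) * S * (constG1star d h α C F D + constG1 h α C F D) + d * D)

/-- The sequence `Υ_k`, `k ≥ 1`, where `Υ_1 = (4ζ)⁻¹ Γ_1` with `Γ_1 = 2 G*_2`, and
`Υ_k = (4ζ)⁻¹ Γ_k + Υ_{k-1}` with `Γ_k = 2 (G*_2 + υ Υ_{k-1})` for `k ≥ 2`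
(the value at `k = 0` is not used). -/
def seqUpsilon (d h : ℕ) (α C F D S : ℝ) : ℕ → ℝ
  | 0 => 0
  | 1 => (4 * constZeta d h α C F D S)⁻¹ * (2 * constG2star d h α C F D)
  | k + 2 => (4 * constZeta d h α C F D S)⁻¹ *
        (2 * (constG2star d h α C F D +
          constUpsilon d h α C F D S * seqUpsilon d h α C F D S (k + 1))) +
      seqUpsilon d h α C F D S (k + 1)

/-- `G = Υ_{⌈(4ζ)^{1/α}⌉} + G*_1`. -/
def constG (d h : ℕ) (α C F D S : ℝ) : ℝ :=
  seqUpsilon d h α C F D S ⌈(4 * constZeta d h α C F D S) ^ (1 / α)⌉₊ + constG1star d h α C F D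

end

end YoungEuler

namespace YoungEuler

open Finset

variable {d h : ℕ}

/-! Everything rests on Young's inequality for left-point sums, `young_discrete`: a sum of v du
differs from its one-term approximation by at most (K(2α) − 1) times the Hölder constants times |t −
s|^{2α}. Applied to f(y) it gives y(t) − y(s) = f(y(s))(x(t) − x(s)) + O(|t − s|^{2α}), the local
error of the scheme. With 2^n steps these errors add up to order Δ^{2α−1}.

To be quantitative, Young's inequality needs explicit Hölder constants. A solution comes only with
finite q-variation of f(y), for an unknown q. One use of the inequality yields some Hölder constant,
and `le_of_absorb` replaces it by 2h|f|C on short intervals; chaining these gives G₁*. The same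
argument bounds the scheme uniformly in the mesh.

The error e = y − y_n solves a linear difference equation with integrand f(y) − f(y_n). The
second-difference bound `abs_sub_sub_sub_le` controls the Hölder seminorm of this integrand by the
seminorm and the supremum of e, and on a short block the seminorm is absorbed (`euler_error_block`).
Dyadic blocks, aligned with the grid and about (4ζ)^{1/α} in number, are chained by
`gronwall_blocks`.

What remains is to dominate the resulting exponential by Υ_M, which grows at least like (1 +
2Q/s)^M, where s = 4ζ, M = ⌈s^{1/α}⌉ and Q is the second-order part of υ. The block growth also
contains the first-order constant b = hd|∇f|C. Landau's inequality |∇f|² ≤ 2|f||∇²f| gives Q ≥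
(3/2)K b², so b can compete with Q only while both are bounded by absolute constants;
`growth_comparison` treats the two regimes. -/

/-! ### The series K(θ) and Young's inequality for discrete sums. -/

theorem summable_rpow_neg_succ {θ : ℝ} (hθ : 1 < θ) :
    Summable fun n : ℕ => ((n : ℝ) + 1) ^ (-θ) := by
  have h := (summable_nat_add_iff 1).2 (Real.summable_nat_rpow.2 (by linarith : -θ < -1))
  simpa using h

theorem sum_rpow_neg_le_constK {θ : ℝ} (hθ : 1 < θ) (N : ℕ) :
    ∑ m ∈ range N, ((m : ℝ) + 1) ^ (-θ) ≤ constK θ - 1 := by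
  have h := (summable_rpow_neg_succ hθ).sum_le_tsum (range N)
    (fun n _ => Real.rpow_nonneg (by positivity) _)
  unfold constK
  linarith

/-- The terms decrease in θ, so θ = 2 is the worst case; seven terms of ∑ m⁻² are the fewest that
exceed 3/2. The numerical margins of `growth_comparison` depend on this value. -/
theorem constK_ge {θ : ℝ} (hθ : 1 < θ) (hθ' : θ ≤ 2) : 5 / 2 ≤ constK θ := by
  have h := sum_rpow_neg_le_constK hθ 7
  have h2 : ∑ m ∈ range 7, ((m : ℝ) + 1) ^ (-(2 : ℝ)) ≤
      ∑ m ∈ range 7, ((m : ℝ) + 1) ^ (-θ) := by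
    refine sum_le_sum fun m _ => Real.rpow_le_rpow_of_exponent_le ?_ (by linarith)
    have : (0 : ℝ) ≤ m := m.cast_nonneg
    linarith
  have h3 : (3 / 2 : ℝ) ≤ ∑ m ∈ range 7, ((m : ℝ) + 1) ^ (-(2 : ℝ)) := by
    simp only [sum_range_succ, sum_range_zero, Real.rpow_neg_ofNat]
    norm_num
  linarith [h3.trans (h2.trans h)]

/-- Among `n + 1` pairs `(a m, b m)` with sums at most `S` and `T`, one has a small product. -/
theorem exists_rpow_mul_rpow_le {β γ : ℝ} (hβ : 0 < β) (hγ : 0 < γ) (n : ℕ) (a b : ℕ → ℝ) (S T : ℝ)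
    (ha : ∀ m ∈ range (n + 1), 0 ≤ a m) (hb : ∀ m ∈ range (n + 1), 0 ≤ b m)
    (hS : ∑ m ∈ range (n + 1), a m ≤ S) (hT : ∑ m ∈ range (n + 1), b m ≤ T) :
    ∃ m ∈ range (n + 1),
      a m ^ β * b m ^ γ ≤ ((n : ℝ) + 1) ^ (-(β + γ)) * (S ^ β * T ^ γ) := by
  have h0 : (0 : ℕ) ∈ range (n + 1) := by simp
  have hle : ∀ (g : ℕ → ℝ) (G : ℝ), (∀ m ∈ range (n + 1), 0 ≤ g m) →
      ∑ m ∈ range (n + 1), g m ≤ G → g 0 ≤ G := fun g G hg hG =>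
    (single_le_sum hg h0).trans hG
  have haS := hle a S ha hS
  have hbT := hle b T hb hT
  have hn : (0 : ℝ) < (n : ℝ) + 1 := by positivity
  rcases (ha 0 h0).trans haS |>.eq_or_lt with hS0 | hS0
  · refine ⟨0, h0, ?_⟩
    have : a 0 = 0 := le_antisymm (hS0 ▸ haS) (ha 0 h0)
    rw [this, ← hS0, Real.zero_rpow hβ.ne']
    simp
  rcases (hb 0 h0).trans hbT |>.eq_or_lt with hT0 | hT0
  · refine ⟨0, h0, ?_⟩
    have : b 0 = 0 := le_antisymm (hT0 ▸ hbT) (hb 0 h0)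
    rw [this, ← hT0, Real.zero_rpow hγ.ne']
    simp
  set θ := β + γ with hθ
  have hθ0 : 0 < θ := by positivity
  -- Pigeonhole on the weighted arithmetic mean of a m / S and b m / T; weighted AM-GM, raised to
  -- the power θ, then turns its smallness into that of the product.
  have hsum : ∑ m ∈ range (n + 1), (β / θ * (a m / S) + γ / θ * (b m / T)) ≤
      ∑ m ∈ range (n + 1), 1 / ((n : ℝ) + 1) := by
    rw [sum_add_distrib, ← mul_sum, ← mul_sum, ← sum_div, ← sum_div, sum_const, card_range]
    have h1 : (∑ m ∈ range (n + 1), a m) / S ≤ 1 := (div_le_one hS0).2 hS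
    have h2 : (∑ m ∈ range (n + 1), b m) / T ≤ 1 := (div_le_one hT0).2 hT
    have h3 : β / θ + γ / θ = 1 := by rw [← add_div, div_self hθ0.ne']
    have h4 : (n + 1) • (1 / ((n : ℝ) + 1)) = 1 := by
      rw [nsmul_eq_mul]; push_cast; field_simp
    rw [h4]
    have := mul_le_mul_of_nonneg_left h1 (div_nonneg hβ.le hθ0.le)
    have := mul_le_mul_of_nonneg_left h2 (div_nonneg hγ.le hθ0.le)
    linarith
  obtain ⟨m, hm, hmle⟩ := exists_le_of_sum_le ⟨0, h0⟩ hsum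
  refine ⟨m, hm, ?_⟩
  have ham := ha m hm
  have hbm := hb m hm
  have hg := Real.geom_mean_le_arith_mean2_weighted (div_nonneg hβ.le hθ0.le)
    (div_nonneg hγ.le hθ0.le) (div_nonneg ham hS0.le) (div_nonneg hbm hT0.le)
    (by rw [← add_div, div_self hθ0.ne'])
  have hg2 := Real.rpow_le_rpow (by positivity) (hg.trans hmle) hθ0.le
  rw [Real.mul_rpow (by positivity) (by positivity), ← Real.rpow_mul (by positivity),
    ← Real.rpow_mul (by positivity), div_mul_cancel₀ _ hθ0.ne', div_mul_cancel₀ _ hθ0.ne',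
    Real.div_rpow ham hS0.le, Real.div_rpow hbm hT0.le, one_div, Real.inv_rpow hn.le,
    ← Real.rpow_neg hn.le] at hg2
  have hSβ : 0 < S ^ β := Real.rpow_pos_of_pos hS0 _
  have hTγ : 0 < T ^ γ := Real.rpow_pos_of_pos hT0 _
  calc a m ^ β * b m ^ γ = (a m ^ β / S ^ β * (b m ^ γ / T ^ γ)) * (S ^ β * T ^ γ) := by
        field_simp
    _ ≤ _ := mul_le_mul_of_nonneg_right hg2 (by positivity)

/-- Removing the point `m + 1` from a Riemann sum. -/
theorem sum_sub_sum_skip (v u : ℕ → ℝ) {n m : ℕ} (hm : m ≤ n) :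
    ∑ i ∈ range (n + 2), v i * (u (i + 1) - u i) -
      ∑ i ∈ range (n + 1), v (if i ≤ m then i else i + 1) *
        (u (if i + 1 ≤ m then i + 1 else i + 1 + 1) - u (if i ≤ m then i else i + 1)) =
      (v (m + 1) - v m) * (u (m + 2) - u (m + 1)) := by
  obtain ⟨r, rfl⟩ := Nat.exists_eq_add_of_le hm
  rw [show m + r + 2 = m + 2 + r by ring, show m + r + 1 = m + 1 + r by ring,
    sum_range_add _ (m + 2) r, sum_range_add _ (m + 1) r, sum_range_succ _ (m + 1),
    sum_range_succ _ m, sum_range_succ _ m]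
  have h1 : ∑ i ∈ range m, v (if i ≤ m then i else i + 1) *
        (u (if i + 1 ≤ m then i + 1 else i + 1 + 1) - u (if i ≤ m then i else i + 1)) =
      ∑ i ∈ range m, v i * (u (i + 1) - u i) := by
    refine sum_congr rfl fun i hi => ?_
    have := mem_range.1 hi
    rw [if_pos (by omega), if_pos (by omega)]
  have h2 : ∑ i ∈ range r, v (if m + 1 + i ≤ m then m + 1 + i else m + 1 + i + 1) *
        (u (if m + 1 + i + 1 ≤ m then m + 1 + i + 1 else m + 1 + i + 1 + 1) -
          u (if m + 1 + i ≤ m then m + 1 + i else m + 1 + i + 1)) =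
      ∑ i ∈ range r, v (m + 2 + i) * (u (m + 2 + i + 1) - u (m + 2 + i)) := by
    refine sum_congr rfl fun i _ => ?_
    rw [if_neg (by omega), if_neg (by omega), show m + 1 + i + 1 = m + 2 + i by ring]
  rw [h1, h2, if_pos le_rfl, if_neg (by omega)]
  ring

/-- Young's maximal inequality for left-point sums along sequences, with the increments of `v` and
`u` controlled by the increments of nondecreasing sequences. -/
theorem young_discrete_aux {β γ : ℝ} (hβ : 0 < β) (hγ : 0 < γ) {A B : ℝ} (hA : 0 ≤ A) (hB : 0 ≤ B)
    (N : ℕ) : ∀ (v u V U : ℕ → ℝ),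
    (∀ i j, i ≤ j → j ≤ N → V i ≤ V j) → (∀ i j, i ≤ j → j ≤ N → U i ≤ U j) →
    (∀ i j, i ≤ j → j ≤ N → |v j - v i| ≤ A * (V j - V i) ^ β) →
    (∀ i j, i ≤ j → j ≤ N → |u j - u i| ≤ B * (U j - U i) ^ γ) →
    |∑ i ∈ range N, v i * (u (i + 1) - u i) - v 0 * (u N - u 0)| ≤
      (∑ m ∈ range (N - 1), ((m : ℝ) + 1) ^ (-(β + γ))) *
        (A * B * ((V N - V 0) ^ β * (U N - U 0) ^ γ)) := by
  induction N with
  | zero => intro v u V U _ _ _ _; simp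
  | succ N ih =>
    intro v u V U hV hU hv hu
    rcases N with _ | n
    · simp
    have hmono : ∀ (W : ℕ → ℝ), (∀ i j, i ≤ j → j ≤ n + 1 + 1 → W i ≤ W j) →
        ∀ i ≤ n + 1, 0 ≤ W (i + 1) - W i := fun W hW i hi =>
      sub_nonneg.2 (hW _ _ (by omega) (by omega))
    -- The interior point m + 1 is the cheapest to delete: its removal costs the increment of v into
    -- it times the increment of u out of it, hence the shifted indices for U.
    obtain ⟨m, hm, hle⟩ := exists_rpow_mul_rpow_le hβ hγ n (fun m => V (m + 1) - V m)
      (fun m => U (m + 2) - U (m + 1)) (V (n + 2) - V 0) (U (n + 2) - U 0)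
      (fun m hm => hmono V hV m (by have := mem_range.1 hm; omega))
      (fun m hm => hmono U hU (m + 1) (by have := mem_range.1 hm; omega))
      (by
        rw [sum_range_sub]
        have := hV (n + 1) (n + 2) (by omega) (by omega)
        linarith)
      (by
        rw [sum_range_sub (fun m => U (m + 1))]
        have := hU 0 1 (by omega) (by omega)
        show U (n + 1 + 1) - U (0 + 1) ≤ _
        simp only [zero_add]
        linarith)
    have hmn : m ≤ n := by have := mem_range.1 hm; omega
    set σ : ℕ → ℕ := fun i => if i ≤ m then i else i + 1 with hσ
    have hσmono : ∀ i j, i ≤ j → j ≤ n + 1 → σ i ≤ σ j ∧ σ j ≤ n + 1 + 1 := by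
      intro i j hij hj
      simp only [hσ]
      split_ifs <;> omega
    have hσ0 : σ 0 = 0 := by simp [hσ]
    have hσN : σ (n + 1) = n + 1 + 1 := by simp only [hσ]; rw [if_neg (by omega)]
    have key := ih (v ∘ σ) (u ∘ σ) (V ∘ σ) (U ∘ σ)
      (fun i j hij hj => hV _ _ (hσmono i j hij hj).1 (hσmono i j hij hj).2)
      (fun i j hij hj => hU _ _ (hσmono i j hij hj).1 (hσmono i j hij hj).2)
      (fun i j hij hj => hv _ _ (hσmono i j hij hj).1 (hσmono i j hij hj).2)
      (fun i j hij hj => hu _ _ (hσmono i j hij hj).1 (hσmono i j hij hj).2)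
    simp only [Function.comp_apply, hσ0, hσN] at key
    have hskip := sum_sub_sum_skip v u hmn
    have hprod : |(v (m + 1) - v m) * (u (m + 2) - u (m + 1))| ≤
        ((n : ℝ) + 1) ^ (-(β + γ)) *
          (A * B * ((V (n + 2) - V 0) ^ β * (U (n + 2) - U 0) ^ γ)) := by
      rw [abs_mul]
      have h1 := hv m (m + 1) (by omega) (by omega)
      have h2 := hu (m + 1) (m + 2) (by omega) (by omega)
      calc _ ≤ (A * (V (m + 1) - V m) ^ β) * (B * (U (m + 2) - U (m + 1)) ^ γ) :=
            mul_le_mul h1 h2 (abs_nonneg _) ((abs_nonneg _).trans h1)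
        _ = A * B * ((V (m + 1) - V m) ^ β * (U (m + 2) - U (m + 1)) ^ γ) := by ring
        _ ≤ A * B * (((n : ℝ) + 1) ^ (-(β + γ)) *
            ((V (n + 2) - V 0) ^ β * (U (n + 2) - U 0) ^ γ)) :=
          mul_le_mul_of_nonneg_left hle (by positivity)
        _ = _ := by ring
    rw [show n + 1 + 1 - 1 = n + 1 by omega,
      sum_range_succ (fun m : ℕ => ((m : ℝ) + 1) ^ (-(β + γ))), add_mul]
    rw [show n + 1 - 1 = n by omega] at key
    have heq : ∑ i ∈ range (n + 1 + 1), v i * (u (i + 1) - u i) - v 0 * (u (n + 1 + 1) - u 0) =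
        (∑ i ∈ range (n + 1), v (σ i) * (u (σ (i + 1)) - u (σ i)) -
          v 0 * (u (n + 1 + 1) - u 0)) + (v (m + 1) - v m) * (u (m + 2) - u (m + 1)) := by
      rw [← hskip]
      ring
    rw [heq]
    exact (abs_add_le _ _).trans (add_le_add key hprod)

/-- The costs of the successive deletions form a partial sum of a convergent series, so the constant
is independent of N and survives the passage to Riemann limits. -/
theorem young_discrete {β γ : ℝ} (hβ : 0 < β) (hγ : 0 < γ) (hθ : 1 < β + γ) {A B : ℝ}
    (hA : 0 ≤ A) (hB : 0 ≤ B) (N : ℕ) (v u V U : ℕ → ℝ)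
    (hV : ∀ i j, i ≤ j → j ≤ N → V i ≤ V j) (hU : ∀ i j, i ≤ j → j ≤ N → U i ≤ U j)
    (hv : ∀ i j, i ≤ j → j ≤ N → |v j - v i| ≤ A * (V j - V i) ^ β)
    (hu : ∀ i j, i ≤ j → j ≤ N → |u j - u i| ≤ B * (U j - U i) ^ γ) :
    |∑ i ∈ range N, v i * (u (i + 1) - u i) - v 0 * (u N - u 0)| ≤
      (constK (β + γ) - 1) * (A * B * ((V N - V 0) ^ β * (U N - U 0) ^ γ)) := by
  refine (young_discrete_aux hβ hγ hA hB N v u V U hV hU hv hu).trans ?_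
  refine mul_le_mul_of_nonneg_right (sum_rpow_neg_le_constK hθ _) ?_
  have h1 := sub_nonneg.2 (hV 0 N (Nat.zero_le _) le_rfl)
  have h2 := sub_nonneg.2 (hU 0 N (Nat.zero_le _) le_rfl)
  positivity

/-- The Hölder case of Young's inequality for matrix-valued integrands. -/
theorem young_discrete_mulVec {α : ℝ} (hα : 1 / 2 < α) {A B : ℝ} (hA : 0 ≤ A)
    (hB : 0 ≤ B) (N : ℕ) (v : ℕ → Matrix (Fin d) (Fin h) ℝ) (u : ℕ → Fin h → ℝ) (t : ℕ → ℝ)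
    (ht : ∀ i j, i ≤ j → j ≤ N → t i ≤ t j)
    (hv : ∀ i j, i ≤ j → j ≤ N → ∀ k l, |v j k l - v i k l| ≤ A * (t j - t i) ^ α)
    (hu : ∀ i j, i ≤ j → j ≤ N → ‖u j - u i‖ ≤ B * (t j - t i) ^ α) :
    ‖∑ i ∈ range N, (v i).mulVec (u (i + 1) - u i) - (v 0).mulVec (u N - u 0)‖ ≤
      (constK (2 * α) - 1) * (h * A * B) * (t N - t 0) ^ (2 * α) := by
  have hK : 0 ≤ constK (2 * α) - 1 := by
    simpa using sum_rpow_neg_le_constK (by linarith : 1 < 2 * α) 0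
  have ht0 : 0 ≤ t N - t 0 := sub_nonneg.2 (ht 0 N (Nat.zero_le _) le_rfl)
  refine (pi_norm_le_iff_of_nonneg (by positivity)).2 fun k => ?_
  have hone : ∀ l, |∑ i ∈ range N, v i k l * (u (i + 1) l - u i l) - v 0 k l * (u N l - u 0 l)| ≤
      (constK (2 * α) - 1) * (A * B * (t N - t 0) ^ (2 * α)) := by
    intro l
    have h := young_discrete (by linarith) (by linarith) (by linarith : 1 < α + α) hA hB N
      (fun i => v i k l) (fun i => u i l) t t ht ht (fun i j hij hj => hv i j hij hj k l)
      (fun i j hij hj => (norm_le_pi_norm (u j - u i) l).trans (hu i j hij hj))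
    rwa [← Real.rpow_add_of_nonneg ht0 (by linarith) (by linarith), ← two_mul] at h
  have heq : (∑ i ∈ range N, (v i).mulVec (u (i + 1) - u i) - (v 0).mulVec (u N - u 0)) k =
      ∑ l, (∑ i ∈ range N, v i k l * (u (i + 1) l - u i l) - v 0 k l * (u N l - u 0 l)) := by
    simp only [Pi.sub_apply, Finset.sum_apply, Matrix.mulVec, dotProduct, sum_sub_distrib]
    rw [sum_comm]
  rw [heq, Real.norm_eq_abs]
  calc _ ≤ ∑ l : Fin h, (constK (2 * α) - 1) * (A * B * (t N - t 0) ^ (2 * α)) :=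
        (abs_sum_le_sum_abs _ _).trans (sum_le_sum fun l _ => hone l)
    _ = _ := by rw [sum_const, card_univ, Fintype.card_fin, nsmul_eq_mul]; ring

/-! ### First and second differences of f, and Landau's inequality. -/

theorem abs_apply_le_of_single (L : (Fin d → ℝ) →L[ℝ] ℝ) {D : ℝ}
    (hD : ∀ k, |L (Pi.single k 1)| ≤ D) (v : Fin d → ℝ) : |L v| ≤ d * D * ‖v‖ := by
  have hv : L v = ∑ k, v k * L (Pi.single k 1) := by
    conv_lhs => rw [pi_eq_sum_univ' v]
    rw [map_sum]
    exact sum_congr rfl fun k _ => by rw [map_smul, smul_eq_mul]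
  rw [hv]
  calc _ ≤ ∑ k : Fin d, ‖v‖ * D := by
        refine (abs_sum_le_sum_abs _ _).trans (sum_le_sum fun k _ => ?_)
        rw [abs_mul]
        exact mul_le_mul (norm_le_pi_norm v k) (hD k) (abs_nonneg _) (norm_nonneg _)
    _ = _ := by rw [sum_const, card_univ, Fintype.card_fin, nsmul_eq_mul]; ring

theorem abs_sub_le_of_partialDeriv {g : (Fin d → ℝ) → ℝ} (hg : Differentiable ℝ g) {D : ℝ}
    (hD0 : 0 ≤ D) (hD : ∀ k z, |partialDeriv k g z| ≤ D) (z w : Fin d → ℝ) :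
    |g z - g w| ≤ d * D * ‖z - w‖ :=
  Convex.norm_image_sub_le_of_norm_fderiv_le (fun x _ => hg x)
    (fun x _ => (fderiv ℝ g x).opNorm_le_bound (by positivity)
      (abs_apply_le_of_single _ fun k => hD k x)) convex_univ (Set.mem_univ w) (Set.mem_univ z)

theorem differentiable_partialDeriv {g : (Fin d → ℝ) → ℝ} (hg : ContDiff ℝ 2 g) (k : Fin d) :
    Differentiable ℝ (partialDeriv k g) := by
  have : ContDiff ℝ 1 (fderiv ℝ g) := hg.fderiv_right (by norm_num)
  exact (this.differentiable (by norm_num)).clm_apply (differentiable_const _)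

/-- The increment of `g` from `z` to `y`, minus that from `z'` to `y'`. -/
theorem abs_sub_sub_sub_le {g : (Fin d → ℝ) → ℝ} (hg : ContDiff ℝ 2 g) {D S : ℝ} (hD0 : 0 ≤ D)
    (hS0 : 0 ≤ S) (hD : ∀ k z, |partialDeriv k g z| ≤ D)
    (hS : ∀ k l z, |partialDeriv l (partialDeriv k g) z| ≤ S) {η : ℝ} (y z y' z' : Fin d → ℝ)
    (hy : ‖y - y'‖ ≤ η) (hz : ‖z - z'‖ ≤ η) :
    |(g y - g z) - (g y' - g z')| ≤
      d * D * ‖(y - z) - (y' - z')‖ + d ^ 2 * S * η * ‖y - z‖ := by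
  have hgd : Differentiable ℝ g := hg.differentiable (by norm_num)
  have hη : 0 ≤ η := (norm_nonneg _).trans hy
  -- The two segments are run through simultaneously: the double increment is the increment of g ∘ p
  -- − g ∘ p' over [0, 1].
  set p : ℝ → Fin d → ℝ := fun τ => z + τ • (y - z) with hp
  set p' : ℝ → Fin d → ℝ := fun τ => z' + τ • (y' - z') with hp'
  have hder : ∀ τ, HasDerivAt (fun τ => g (p τ) - g (p' τ))
      (fderiv ℝ g (p τ) (y - z) - fderiv ℝ g (p' τ) (y' - z')) τ := by
    intro τ
    have hpτ : ∀ a b : Fin d → ℝ, HasDerivAt (fun τ : ℝ => a + τ • b) b τ := fun a b => by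
      simpa using ((hasDerivAt_id τ).smul_const b).const_add a
    exact ((hgd (p τ)).hasFDerivAt.comp_hasDerivAt τ (hpτ z (y - z))).sub
      ((hgd (p' τ)).hasFDerivAt.comp_hasDerivAt τ (hpτ z' (y' - z')))
  have hbound : ∀ τ ∈ Set.Ico (0 : ℝ) 1,
      ‖fderiv ℝ g (p τ) (y - z) - fderiv ℝ g (p' τ) (y' - z')‖ ≤
        d * D * ‖(y - z) - (y' - z')‖ + d ^ 2 * S * η * ‖y - z‖ := by
    intro τ hτ
    have hpp : ‖p τ - p' τ‖ ≤ η := by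
      have : p τ - p' τ = (1 - τ) • (z - z') + τ • (y - y') := by
        simp only [hp, hp']; module
      rw [this]
      refine (norm_add_le _ _).trans ?_
      rw [norm_smul, norm_smul, Real.norm_of_nonneg hτ.1,
        Real.norm_of_nonneg (by linarith [hτ.2] : 0 ≤ 1 - τ)]
      nlinarith [hτ.1, hτ.2]
    have h1 := abs_apply_le_of_single (fderiv ℝ g (p' τ)) (fun k => hD k (p' τ))
      ((y - z) - (y' - z'))
    have h2 := abs_apply_le_of_single (fderiv ℝ g (p τ) - fderiv ℝ g (p' τ))
      (D := d * S * η) (fun k => by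
        have := abs_sub_le_of_partialDeriv (differentiable_partialDeriv hg k) hS0
          (fun l z => hS k l z) (p τ) (p' τ)
        exact this.trans (mul_le_mul_of_nonneg_left hpp (by positivity))) (y - z)
    -- One derivative meets the difference of the directions, the difference of the derivatives
    -- meets y − z; only the latter needs second derivatives.
    have heq : fderiv ℝ g (p τ) (y - z) - fderiv ℝ g (p' τ) (y' - z') =
        fderiv ℝ g (p' τ) ((y - z) - (y' - z')) +
          (fderiv ℝ g (p τ) - fderiv ℝ g (p' τ)) (y - z) := by
      simp only [map_sub, sub_apply]; ring
    rw [heq]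
    refine (norm_add_le _ _).trans (add_le_add h1 (h2.trans (le_of_eq (by ring))))
  have := norm_image_sub_le_of_norm_deriv_le_segment_01'
    (fun τ _ => (hder τ).hasDerivWithinAt) hbound
  have e1 : g (p 1) - g (p' 1) - (g (p 0) - g (p' 0)) = (g y - g z) - (g y' - g z') := by
    simp only [hp, hp', one_smul, zero_smul, add_zero, add_sub_cancel]; ring
  rwa [e1] at this

/-- Landau's inequality on the line. -/
theorem sq_deriv_le_of_bounded {g g' : ℝ → ℝ} {F S : ℝ} (hF : ∀ t, |g t| ≤ F)
    (hg : ∀ t, HasDerivAt g (g' t) t) (hS : ∀ t s, |g' t - g' s| ≤ S * |t - s|) (hS0 : 0 ≤ S) :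
    g' 0 ^ 2 ≤ 2 * F * S := by
  have hF0 : 0 ≤ F := (abs_nonneg _).trans (hF 0)
  -- The symmetric difference g(a) − g(−a) differs from 2a g'(0) by at most S a², since the
  -- derivative of the discrepancy at t is at most 2St.
  have key : ∀ a : ℝ, 0 ≤ a → 2 * a * |g' 0| ≤ 2 * F + S * a ^ 2 := by
    intro a ha
    have hψ : ∀ t, HasDerivAt (fun t => g t - g (-t) - 2 * t * g' 0)
        (g' t + g' (-t) - 2 * g' 0) t := fun t => by
      have h1 := (hg (-t)).scomp t (hasDerivAt_neg t)
      have h2 := ((hasDerivAt_id t).const_mul (2 : ℝ)).mul_const (g' 0)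
      exact (((hg t).sub h1).sub h2).congr_deriv (by simp)
    have hB : ∀ t, HasDerivAt (fun t => S * t ^ 2) (2 * S * t) t := fun t => by
      exact (((hasDerivAt_id t).pow 2).const_mul S).congr_deriv (by simp; ring)
    have h := image_norm_le_of_norm_deriv_right_le_deriv_boundary (a := 0) (b := a)
      (f := fun t => g t - g (-t) - 2 * t * g' 0) (f' := fun t => g' t + g' (-t) - 2 * g' 0)
      (B := fun t => S * t ^ 2) (B' := fun t => 2 * S * t)
      (fun t _ => (hψ t).continuousAt.continuousWithinAt)
      (fun t _ => (hψ t).hasDerivWithinAt) (by simp) hB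
      (fun t ht => by
        have h1 := hS t 0
        have h2 := hS (-t) 0
        rw [sub_zero, abs_of_nonneg ht.1] at h1
        rw [sub_zero, abs_neg, abs_of_nonneg ht.1] at h2
        have : g' t + g' (-t) - 2 * g' 0 = (g' t - g' 0) + (g' (-t) - g' 0) := by ring
        rw [this]
        refine (norm_add_le _ _).trans ?_
        simp only [Real.norm_eq_abs]
        linarith) (Set.right_mem_Icc.2 ha)
    simp only [Real.norm_eq_abs] at h
    have h3 : 2 * a * |g' 0| = |2 * a * g' 0| := by
      rw [abs_mul, abs_of_nonneg (by positivity : 0 ≤ 2 * a)]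
    have h4 : 2 * a * g' 0 = g a - g (-a) - (g a - g (-a) - 2 * a * g' 0) := by ring
    have h5 := abs_sub (g a - g (-a)) (g a - g (-a) - 2 * a * g' 0)
    have h6 := abs_sub (g a) (g (-a))
    rw [← h4, ← h3] at h5
    linarith [hF a, hF (-a)]
  rw [← sq_abs]
  rcases hS0.eq_or_lt with rfl | hSpos
  · have h0 : |g' 0| ≤ 0 := by
      by_contra! hpos
      have := key ((F + 1) / |g' 0|) (by positivity)
      rw [mul_assoc, div_mul_cancel₀ _ hpos.ne'] at this
      linarith
    have : |g' 0| = 0 := le_antisymm h0 (abs_nonneg _)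
    rw [this]; simp
  -- This a makes the bound from `key` optimal.
  · have := key (|g' 0| / S) (by positivity)
    have e1 : 2 * (|g' 0| / S) * |g' 0| = 2 * |g' 0| ^ 2 / S := by ring
    have e2 : S * (|g' 0| / S) ^ 2 = |g' 0| ^ 2 / S := by field_simp
    rw [e1, e2] at this
    have h3 : |g' 0| ^ 2 / S ≤ 2 * F := by
      have : 2 * |g' 0| ^ 2 / S = |g' 0| ^ 2 / S + |g' 0| ^ 2 / S := by ring
      linarith
    rwa [div_le_iff₀ hSpos] at h3

theorem sq_partialDeriv_le {g : (Fin d → ℝ) → ℝ} (hg : ContDiff ℝ 2 g) {F S : ℝ}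
    (hS0 : 0 ≤ S) (hF : ∀ z, |g z| ≤ F)
    (hS : ∀ k l z, |partialDeriv l (partialDeriv k g) z| ≤ S) (k : Fin d) (z : Fin d → ℝ) :
    partialDeriv k g z ^ 2 ≤ 2 * F * S := by
  set e : Fin d → ℝ := Pi.single k 1 with he
  have hl : ∀ t : ℝ, HasDerivAt (fun t : ℝ => z + t • e) e t := fun t => by
    simpa using ((hasDerivAt_id t).smul_const e).const_add z
  have hgd : Differentiable ℝ g := hg.differentiable (by norm_num)
  have h1 : ∀ t : ℝ, HasDerivAt (fun t : ℝ => g (z + t • e)) (partialDeriv k g (z + t • e)) t :=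
    fun t => (hgd _).hasFDerivAt.comp_hasDerivAt t (hl t)
  have h2 : ∀ t : ℝ, HasDerivAt (fun t : ℝ => partialDeriv k g (z + t • e))
      (partialDeriv k (partialDeriv k g) (z + t • e)) t :=
    fun t => (differentiable_partialDeriv hg k _).hasFDerivAt.comp_hasDerivAt t (hl t)
  have := sq_deriv_le_of_bounded (fun t => hF _) h1 (fun t s =>
    Convex.norm_image_sub_le_of_norm_hasDerivWithin_le (fun x _ => (h2 x).hasDerivWithinAt)
      (fun x _ => hS k k _) convex_univ (Set.mem_univ s) (Set.mem_univ t)) hS0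
  simpa using this

section sups

variable {f : (Fin d → ℝ) → Matrix (Fin d) (Fin h) ℝ}

theorem le_supAbs (hf : IsC2Bounded f) (z i j) : |f z i j| ≤ supAbs f := by
  obtain ⟨M, hM⟩ := hf.bounded
  refine le_ciSup (f := fun q : (Fin d → ℝ) × Fin d × Fin h => |f q.1 q.2.1 q.2.2|)
    ⟨M, ?_⟩ (z, i, j)
  rintro _ ⟨q, rfl⟩
  exact hM _ _ _

theorem le_supGrad (hf : IsC2Bounded f) (i j k z) :
    |partialDeriv k (fun z => f z i j) z| ≤ supGrad f := by
  obtain ⟨M, hM⟩ := hf.bounded_grad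
  refine le_ciSup (f := fun q : (Fin d → ℝ) × Fin d × Fin h × Fin d =>
    |partialDeriv q.2.2.2 (fun z => f z q.2.1 q.2.2.1) q.1|) ⟨M, ?_⟩ (z, i, j, k)
  rintro _ ⟨q, rfl⟩
  exact hM _ _ _ _

theorem le_supHess (hf : IsC2Bounded f) (i j k l z) :
    |partialDeriv l (partialDeriv k (fun z => f z i j)) z| ≤ supHess f := by
  obtain ⟨M, hM⟩ := hf.bounded_hess
  refine le_ciSup (f := fun q : (Fin d → ℝ) × Fin d × Fin h × Fin d × Fin d =>
    |partialDeriv q.2.2.2.2 (partialDeriv q.2.2.2.1 (fun z => f z q.2.1 q.2.2.1)) q.1|)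
    ⟨M, ?_⟩ (z, i, j, k, l)
  rintro _ ⟨q, rfl⟩
  exact hM _ _ _ _ _

theorem supAbs_nonneg : 0 ≤ supAbs f := Real.iSup_nonneg fun _ => abs_nonneg _

theorem supGrad_nonneg : 0 ≤ supGrad f := Real.iSup_nonneg fun _ => abs_nonneg _

theorem supHess_nonneg : 0 ≤ supHess f := Real.iSup_nonneg fun _ => abs_nonneg _

/-- Landau's inequality on every coordinate line. It serves to dominate first-order growth by
second-order growth, the only kind retained when bounding Υ_k from below. -/
theorem sq_supGrad_le (hf : IsC2Bounded f) : supGrad f ^ 2 ≤ 2 * supAbs f * supHess f := by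
  have h : supGrad f ≤ √(2 * supAbs f * supHess f) :=
    Real.iSup_le (fun q => Real.abs_le_sqrt (sq_partialDeriv_le (hf.contDiff _ _) supHess_nonneg
      (fun z => le_supAbs hf z _ _) (fun k l z => le_supHess hf _ _ k l z) _ _)) (Real.sqrt_nonneg _)
  have h2 := pow_le_pow_left₀ supGrad_nonneg h 2
  rwa [Real.sq_sqrt (mul_nonneg (mul_nonneg zero_le_two supAbs_nonneg) supHess_nonneg)] at h2

theorem abs_sub_le_supGrad (hf : IsC2Bounded f) (z w i j) :
    |f z i j - f w i j| ≤ d * supGrad f * ‖z - w‖ :=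
  abs_sub_le_of_partialDeriv (g := fun z => f z i j) ((hf.contDiff i j).differentiable (by norm_num))
    supGrad_nonneg (fun k z => le_supGrad hf i j k z) z w

theorem pos_of_nonconst (hf : IsC2Bounded f) (hf' : ∃ z w, f z ≠ f w) :
    0 < d ∧ 0 < h ∧ 0 < supAbs f ∧ 0 < supGrad f := by
  obtain ⟨z, w, hzw⟩ := hf'
  obtain ⟨i, j, hij⟩ : ∃ i j, f z i j ≠ f w i j := by
    by_contra! hall
    exact hzw (by ext i j; exact hall i j)
  refine ⟨i.pos, j.pos, ?_, ?_⟩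
  · by_contra! hle
    have h0 : ∀ z, f z i j = 0 := fun z => abs_eq_zero.1
      (le_antisymm ((le_supAbs hf z i j).trans hle) (abs_nonneg _))
    exact hij (by rw [h0, h0])
  · by_contra! hle
    have h0 : supGrad f = 0 := le_antisymm hle supGrad_nonneg
    have := abs_sub_le_supGrad hf z w i j
    rw [h0, mul_zero, zero_mul] at this
    exact hij (sub_eq_zero.1 (abs_eq_zero.1 (le_antisymm this (abs_nonneg _))))

end sups

/-! ### Absorption, Riemann limits on subintervals, and controls. -/

/-- A bound that improves itself by an affine contraction holds with the fixed point. -/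
theorem le_of_absorb {ι : Type*} {φ ψ : ι → ℝ} {H₀ a r : ℝ} (hψ : ∀ i, 0 ≤ ψ i) (hH : 0 ≤ H₀)
    (ha : 0 ≤ a) (hr : 0 ≤ r) (hr1 : r < 1) (h0 : ∀ i, φ i ≤ H₀ * ψ i)
    (hstep : ∀ H, 0 ≤ H → (∀ i, φ i ≤ H * ψ i) → ∀ i, φ i ≤ (a + r * H) * ψ i) (i : ι) :
    φ i ≤ a / (1 - r) * ψ i := by
  have h1r : 0 < 1 - r := by linarith
  -- The a priori constant H₀ may be arbitrarily bad, but must be finite: its contribution decays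
  -- like r^n.
  have hn : ∀ n : ℕ, ∀ i, φ i ≤ (a / (1 - r) + r ^ n * H₀) * ψ i := by
    intro n
    induction n with
    | zero =>
      intro i
      refine (h0 i).trans (mul_le_mul_of_nonneg_right ?_ (hψ i))
      have : 0 ≤ a / (1 - r) := by positivity
      simpa using this
    | succ n ih =>
      intro i
      have := hstep _ (by positivity) ih i
      have e : a + r * (a / (1 - r) + r ^ n * H₀) = a / (1 - r) + r ^ (n + 1) * H₀ := by
        field_simp; ring
      rwa [e] at this
  have hlim : Filter.Tendsto (fun n : ℕ => (a / (1 - r) + r ^ n * H₀) * ψ i) Filter.atTop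
      (nhds ((a / (1 - r) + 0 * H₀) * ψ i)) :=
    (((tendsto_pow_atTop_nhds_zero_of_lt_one hr hr1).mul_const H₀).const_add _).mul_const _
  rw [zero_mul, add_zero] at hlim
  exact ge_of_tendsto' hlim fun n => hn n i

theorem IsPartition.mem {t : ℕ → ℝ} {N : ℕ} {a b : ℝ} (ht : IsPartition t N a b) {i : ℕ}
    (hi : i ≤ N) : t i ∈ Set.Icc a b :=
  ⟨ht.2.1 ▸ ht.1 (Nat.zero_le i), ht.2.2 ▸ ht.1 hi⟩

theorem IsPartition.concat {t₁ t₂ : ℕ → ℝ} {N₁ N₂ : ℕ} {a b c : ℝ} (h₁ : IsPartition t₁ N₁ a b)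
    (h₂ : IsPartition t₂ N₂ b c) :
    IsPartition (fun i => if i < N₁ then t₁ i else t₂ (i - N₁)) (N₁ + N₂) a c := by
  refine ⟨fun i j hij => ?_, ?_, ?_⟩
  · simp only
    split_ifs with hi hj hj
    · exact h₁.1 hij
    · exact (h₁.mem hi.le).2.trans (h₂.2.1 ▸ h₂.1 (Nat.zero_le _))
    · omega
    · exact h₂.1 (by omega)
  · simp only
    split_ifs with h0
    · exact h₁.2.1
    · obtain rfl : N₁ = 0 := by omega
      rw [Nat.sub_zero, h₂.2.1, ← h₁.2.2, h₁.2.1]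
  · simp [h₂.2.2]

theorem concat_apply_add {t₁ t₂ : ℕ → ℝ} {N₁ : ℕ} (i : ℕ) :
    (fun i => if i < N₁ then t₁ i else t₂ (i - N₁)) (N₁ + i) = t₂ i := by
  simp

theorem IsPartition.concat_apply_of_le {t₁ t₂ : ℕ → ℝ} {N₁ N₂ : ℕ} {a b c : ℝ}
    (h₁ : IsPartition t₁ N₁ a b) (h₂ : IsPartition t₂ N₂ b c) {i : ℕ} (hi : i ≤ N₁) :
    (fun i => if i < N₁ then t₁ i else t₂ (i - N₁)) i = t₁ i := by
  rcases hi.lt_or_eq with hi | rfl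
  · simp [hi]
  · simp [h₁.2.2, h₂.2.1]

theorem exists_fine_partition {a b δ : ℝ} (hab : a ≤ b) (hδ : 0 < δ) :
    ∃ (N : ℕ) (t : ℕ → ℝ), IsPartition t N a b ∧ ∀ i < N, t (i + 1) - t i < δ := by
  obtain ⟨n, hn⟩ := exists_nat_gt ((b - a) / δ)
  set N := n + 1 with hN
  have hN0 : (0 : ℝ) < N := by positivity
  refine ⟨N, fun i => a + (b - a) * (min i N : ℕ) / N, ⟨fun i j hij => ?_, by simp, ?_⟩,
    fun i hi => ?_⟩
  · have : ((min i N : ℕ) : ℝ) ≤ (min j N : ℕ) := by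
      exact_mod_cast min_le_min_right N hij
    have h2 := mul_le_mul_of_nonneg_left this (sub_nonneg.2 hab)
    simp only
    gcongr
  · simp only [min_self]
    field_simp
    ring
  · have e1 : min (i + 1) N = i + 1 := min_eq_left hi
    have e2 : min i N = i := min_eq_left hi.le
    simp only [e1, e2]
    have : a + (b - a) * ((i + 1 : ℕ) : ℝ) / N - (a + (b - a) * (i : ℝ) / N) = (b - a) / N := by
      push_cast; field_simp; ring
    rw [this, div_lt_iff₀ hN0]
    rw [div_lt_iff₀ hδ] at hn
    have : (N : ℝ) = n + 1 := by push_cast [hN]; ring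
    rw [this]
    nlinarith

/-- Additivity of the Riemann limit over consecutive intervals. -/
theorem RiemannSumsTendTo.sub {v u : ℝ → ℝ} {a s t I J : ℝ} (has : a ≤ s)
    (hI : RiemannSumsTendTo v u a s I) (hJ : RiemannSumsTendTo v u a t J) :
    RiemannSumsTendTo v u s t (J - I) := by
  intro ε hε
  obtain ⟨δ₁, hδ₁, h₁⟩ := hI (ε / 2) (by positivity)
  obtain ⟨δ₂, hδ₂, h₂⟩ := hJ (ε / 2) (by positivity)
  refine ⟨δ₂, hδ₂, fun N τ hτ hmesh => ?_⟩
  -- One partition of [a, s], fine enough for both limits, is put in front of τ; its sum cancels up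
  -- to the two errors ε/2.
  obtain ⟨N₁, τ₁, hτ₁, hmesh₁⟩ := exists_fine_partition has (lt_min hδ₁ hδ₂)
  have e₁ := h₁ N₁ τ₁ hτ₁ fun i hi => (hmesh₁ i hi).trans_le (min_le_left _ _)
  set σ : ℕ → ℝ := fun i => if i < N₁ then τ₁ i else τ (i - N₁) with hσ
  have hσle : ∀ i ≤ N₁, σ i = τ₁ i := fun i hi => hτ₁.concat_apply_of_le hτ hi
  have hσadd : ∀ i, σ (N₁ + i) = τ i := fun i => concat_apply_add i
  have e₂ := h₂ (N₁ + N) σ (hτ₁.concat hτ) fun i hi => by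
    rcases lt_or_ge i N₁ with hi' | hi'
    · rw [hσle i hi'.le, hσle (i + 1) hi']
      exact (hmesh₁ i hi').trans_le (min_le_right _ _)
    · obtain ⟨k, rfl⟩ := Nat.exists_eq_add_of_le hi'
      rw [add_assoc, hσadd, hσadd]
      exact hmesh k (by omega)
  rw [sum_range_add] at e₂
  have s1 : ∑ i ∈ range N₁, v (σ i) * (u (σ (i + 1)) - u (σ i)) =
      ∑ i ∈ range N₁, v (τ₁ i) * (u (τ₁ (i + 1)) - u (τ₁ i)) := sum_congr rfl fun i hi => by
    have := mem_range.1 hi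
    rw [hσle i this.le, hσle (i + 1) this]
  have s2 : ∑ i ∈ range N, v (σ (N₁ + i)) * (u (σ (N₁ + i + 1)) - u (σ (N₁ + i))) =
      ∑ i ∈ range N, v (τ i) * (u (τ (i + 1)) - u (τ i)) := sum_congr rfl fun i _ => by
    rw [add_assoc, hσadd, hσadd]
  rw [s1, s2] at e₂
  rw [abs_lt] at *
  constructor <;> linarith [e₁.1, e₁.2, e₂.1, e₂.2]

/-- The Young--Loève estimate for a limit of Riemann sums. -/
theorem RiemannSumsTendTo.young {v u V U : ℝ → ℝ} {s t I A B β γ : ℝ}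
    (hI : RiemannSumsTendTo v u s t I) (hst : s ≤ t) (hβ : 0 < β) (hγ : 0 < γ) (hθ : 1 < β + γ)
    (hA : 0 ≤ A) (hB : 0 ≤ B) (hV : MonotoneOn V (Set.Icc s t)) (hU : MonotoneOn U (Set.Icc s t))
    (hv : ∀ a b, s ≤ a → a ≤ b → b ≤ t → |v b - v a| ≤ A * (V b - V a) ^ β)
    (hu : ∀ a b, s ≤ a → a ≤ b → b ≤ t → |u b - u a| ≤ B * (U b - U a) ^ γ) :
    |I - v s * (u t - u s)| ≤
      (constK (β + γ) - 1) * (A * B * ((V t - V s) ^ β * (U t - U s) ^ γ)) := by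
  refine le_of_forall_pos_le_add fun ε hε => ?_
  obtain ⟨δ, hδ, h⟩ := hI ε hε
  obtain ⟨N, τ, hτ, hmesh⟩ := exists_fine_partition hst hδ
  have h1 := h N τ hτ hmesh
  have hmem : ∀ i ≤ N, τ i ∈ Set.Icc s t := fun i hi => hτ.mem hi
  have h2 := young_discrete hβ hγ hθ hA hB N (v ∘ τ) (u ∘ τ) (V ∘ τ) (U ∘ τ)
    (fun i j hij hj => hV (hmem i (hij.trans hj)) (hmem j hj) (hτ.1 hij))
    (fun i j hij hj => hU (hmem i (hij.trans hj)) (hmem j hj) (hτ.1 hij))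
    (fun i j hij hj => hv _ _ (hmem i (hij.trans hj)).1 (hτ.1 hij) (hmem j hj).2)
    (fun i j hij hj => hu _ _ (hmem i (hij.trans hj)).1 (hτ.1 hij) (hmem j hj).2)
  simp only [Function.comp_apply, hτ.2.1, hτ.2.2] at h2
  have h3 := abs_sub_le I (∑ i ∈ range N, v (τ i) * (u (τ (i + 1)) - u (τ i)))
    (v s * (u t - u s))
  rw [abs_sub_comm] at h1
  linarith

/-- A path of finite `p`-variation is controlled by the increments of a nondecreasing function. -/
theorem HasFinitePVariation.exists_control {p : ℝ} {u : ℝ → ℝ} {T : ℝ} (hp : 0 < p)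
    (hu : HasFinitePVariation p u 0 T) :
    ∃ V : ℝ → ℝ, MonotoneOn V (Set.Icc 0 T) ∧
      ∀ s t, 0 ≤ s → s ≤ t → t ≤ T → |u t - u s| ≤ (V t - V s) ^ (1 / p) := by
  obtain ⟨M, hM⟩ := hu
  -- The control is sup W(t), the p-variation on [0, t]. Appending the point t to a partition of [0,
  -- s] shows that its increment dominates |u(t) − u(s)|^p.
  set W : ℝ → Set ℝ := fun t => {r | ∃ (N : ℕ) (τ : ℕ → ℝ), IsPartition τ N 0 t ∧
    r = ∑ i ∈ range N, |u (τ (i + 1)) - u (τ i)| ^ p} with hW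
  have happ : ∀ s t r, s ≤ t → r ∈ W s → r + |u t - u s| ^ p ∈ W t := by
    rintro s t r hst ⟨N, τ, hτ, rfl⟩
    have hc : IsPartition (fun i => if i = 0 then s else t) 1 s t :=
      ⟨fun i j hij => by simp only; split_ifs <;> first | omega | linarith, by simp, by simp⟩
    set σ : ℕ → ℝ := fun i => if i < N then τ i else
      (fun i => if i = 0 then s else t) (i - N) with hσ
    have hσle : ∀ i ≤ N, σ i = τ i := fun i hi => hτ.concat_apply_of_le hc hi
    refine ⟨N + 1, σ, hτ.concat hc, ?_⟩
    rw [sum_range_succ]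
    congr 1
    · refine sum_congr rfl fun i hi => ?_
      have := mem_range.1 hi
      rw [hσle i this.le, hσle (i + 1) this]
    · rw [hσle N le_rfl, hτ.2.2]
      simp [hσ]
  have hbdd : ∀ t, t ≤ T → BddAbove (W t) := fun t htT => ⟨M, fun r hr => by
    obtain ⟨N, τ, hτ, h⟩ := happ t T r htT hr
    have h1 := hM N τ hτ
    rw [← h] at h1
    have h2 : 0 ≤ |u T - u t| ^ p := by positivity
    linarith⟩
  have hne : ∀ t, 0 ≤ t → (W t).Nonempty := fun t ht =>
    ⟨_, happ 0 t _ ht ⟨0, fun _ => 0, ⟨monotone_const, rfl, rfl⟩, rfl⟩⟩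
  have hkey : ∀ s t, 0 ≤ s → s ≤ t → t ≤ T → sSup (W s) + |u t - u s| ^ p ≤ sSup (W t) := by
    intro s t hs hst ht
    rw [← le_sub_iff_add_le]
    refine csSup_le (hne s hs) fun r hr => ?_
    rw [le_sub_iff_add_le]
    exact le_csSup (hbdd t ht) (happ s t r hst hr)
  refine ⟨fun t => sSup (W t), fun s hs t ht hst => ?_, fun s t hs hst ht => ?_⟩
  · have := hkey s t hs.1 hst ht.2
    have h2 : 0 ≤ |u t - u s| ^ p := by positivity
    simp only
    linarith
  · have := hkey s t hs hst ht
    rw [one_div, Real.le_rpow_inv_iff_of_pos (abs_nonneg _) ?_ hp]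
    · linarith
    · have h2 : 0 ≤ |u t - u s| ^ p := by positivity
      linarith

/-! ### Regularity of Young solutions. -/

theorem IsYoungSolution.apply_zero {f : (Fin d → ℝ) → Matrix (Fin d) (Fin h) ℝ}
    {x : ℝ → Fin h → ℝ} {y₀ : Fin d → ℝ} {y : ℝ → Fin d → ℝ} (hy : IsYoungSolution f x y₀ y) :
    y 0 = y₀ := by
  obtain ⟨J, hJ, hyJ⟩ := hy 0 (by simp)
  have hJ0 : ∀ i j, J i j = 0 := fun i j => by
    by_contra hne
    obtain ⟨δ, _, hδ⟩ := (hJ i j).2.2.2 |J i j| (abs_pos.2 hne)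
    have := hδ 0 (fun _ => 0) ⟨monotone_const, rfl, rfl⟩ (by simp)
    simp at this
  ext i
  simp [hyJ i, hJ0]

/-- The solution is the sum of `y₀` and integrals whose increments are Riemann limits. -/
theorem IsYoungSolution.exists_increments {f : (Fin d → ℝ) → Matrix (Fin d) (Fin h) ℝ}
    {x : ℝ → Fin h → ℝ} {y₀ : Fin d → ℝ} {y : ℝ → Fin d → ℝ} (hy : IsYoungSolution f x y₀ y) :
    ∃ J : ℝ → Matrix (Fin d) (Fin h) ℝ,
      (∀ s t, 0 ≤ s → s ≤ t → t ≤ 1 → ∀ i j,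
        RiemannSumsTendTo (fun r => f (y r) i j) (fun r => x r j) s t (J t i j - J s i j)) ∧
      ∀ s t, 0 ≤ s → s ≤ t → t ≤ 1 → ∀ i, y t i - y s i = ∑ j, (J t i j - J s i j) := by
  have hy' : ∀ t : ℝ, ∃ J : Matrix (Fin d) (Fin h) ℝ, t ∈ Set.Icc (0 : ℝ) 1 →
    (∀ i j, IsYoungIntegral (fun s => f (y s) i j) (fun s => x s j) 0 t (J i j)) ∧
    ∀ i, y t i = y₀ i + ∑ j, J i j := fun t => by
      by_cases ht : t ∈ Set.Icc (0 : ℝ) 1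
      · exact (hy t ht).imp fun J hJ _ => hJ
      · exact ⟨0, fun h => (ht h).elim⟩
  choose J hJ using hy'
  refine ⟨J, fun s t hs hst ht i j => ?_, fun s t hs hst ht i => ?_⟩
  · exact ((hJ s ⟨hs, hst.trans ht⟩).1 i j).2.2.2.sub hs
      ((hJ t ⟨hs.trans hst, ht⟩).1 i j).2.2.2
  · rw [(hJ s ⟨hs, hst.trans ht⟩).2 i, (hJ t ⟨hs.trans hst, ht⟩).2 i, sum_sub_distrib]
    ring

theorem abs_le_mul_rpow_of_le {a b γ α X : ℝ} (hα : 0 ≤ α) (hγ : α ≤ γ) (ha : 0 ≤ a) (hX : 0 ≤ X)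
    (hab : a ≤ X) (hb : 0 ≤ b) : b * a ^ γ ≤ b * X ^ (γ - α) * a ^ α := by
  have h1 : a ^ γ = a ^ (γ - α) * a ^ α := by
    rw [← Real.rpow_add_of_nonneg ha (by linarith) hα, sub_add_cancel]
  rw [h1, ← mul_assoc]
  have := Real.rpow_le_rpow ha hab (by linarith : 0 ≤ γ - α)
  gcongr

theorem constK_sub_one_nonneg {θ : ℝ} (hθ : 1 < θ) : 0 ≤ constK θ - 1 := by
  simpa using sum_rpow_neg_le_constK hθ 0

theorem norm_mulVec_le {A : Matrix (Fin d) (Fin h) ℝ} {F : ℝ} (hF0 : 0 ≤ F)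
    (hA : ∀ i j, |A i j| ≤ F) (v : Fin h → ℝ) : ‖A.mulVec v‖ ≤ h * F * ‖v‖ := by
  refine (pi_norm_le_iff_of_nonneg (by positivity)).2 fun i => ?_
  calc |∑ j, A i j * v j| ≤ ∑ _j : Fin h, F * ‖v‖ := by
        refine (abs_sum_le_sum_abs _ _).trans (sum_le_sum fun j _ => ?_)
        rw [abs_mul]
        exact mul_le_mul (hA i j) (norm_le_pi_norm v j) (abs_nonneg _) hF0
    _ = _ := by rw [sum_const, card_univ, Fintype.card_fin, nsmul_eq_mul]; ring

/-- A Young solution driven by an `α`-Hölder path has finite `1/α`-variation. -/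
theorem IsYoungSolution.exists_control {α C F : ℝ} (hα : 1 / 2 < α) (hC : 0 ≤ C)
    {f : (Fin d → ℝ) → Matrix (Fin d) (Fin h) ℝ} (hF0 : 0 ≤ F) (hF : ∀ z i j, |f z i j| ≤ F)
    {x : ℝ → Fin h → ℝ}
    (hx : ∀ s ∈ Set.Icc (0 : ℝ) 1, ∀ t ∈ Set.Icc (0 : ℝ) 1, ‖x t - x s‖ ≤ C * |t - s| ^ α)
    {y₀ : Fin d → ℝ} {y : ℝ → Fin d → ℝ} (hy : IsYoungSolution f x y₀ y) :
    ∃ (V : ℝ → ℝ) (B : ℝ), 0 ≤ B ∧ MonotoneOn V (Set.Icc 0 1) ∧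
      ∀ s t, 0 ≤ s → s ≤ t → t ≤ 1 → ‖y t - y s‖ ≤ B * (V t - V s) ^ α := by
  obtain ⟨J, hJ, hyJ⟩ := hy.exists_increments
  have hij : ∀ i j, ∃ (U : ℝ → ℝ) (B : ℝ), 0 ≤ B ∧ MonotoneOn U (Set.Icc 0 1) ∧
      ∀ s t, 0 ≤ s → s ≤ t → t ≤ 1 → |J t i j - J s i j| ≤ B * (U t - U s) ^ α := by
    intro i j
    obtain ⟨J', hJ', -⟩ := hy 1 (by simp)
    obtain ⟨-, -, ⟨p, q, hp, hq, hpq, hup, hvq⟩, -⟩ := hJ' i j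
    obtain ⟨V, hV, hvV⟩ := hvq.exists_control (by linarith)
    -- The exponent p given with the integral need not match α. The better of 1/p and α is kept, so
    -- that both 1/q + γ > 1 and γ ≥ α hold.
    obtain ⟨U, γ, B, hB, hγα, hγq, hU, huU⟩ : ∃ (U : ℝ → ℝ) (γ B : ℝ), 0 ≤ B ∧ α ≤ γ ∧
        1 < 1 / q + γ ∧ MonotoneOn U (Set.Icc 0 1) ∧
        ∀ s t, 0 ≤ s → s ≤ t → t ≤ 1 → |x t j - x s j| ≤ B * (U t - U s) ^ γ := by
      rcases le_total (1 / p) α with hpα | hpα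
      · refine ⟨id, α, C, hC, le_rfl, by linarith, monotone_id.monotoneOn _,
          fun s t hs hst ht => ?_⟩
        have := hx s ⟨hs, hst.trans ht⟩ t ⟨hs.trans hst, ht⟩
        rw [abs_of_nonneg (sub_nonneg.2 hst)] at this
        exact (norm_le_pi_norm (x t - x s) j).trans this
      · obtain ⟨U, hU, huU⟩ := hup.exists_control (by linarith)
        exact ⟨U, 1 / p, 1, zero_le_one, hpα, by linarith, hU,
          fun s t hs hst ht => by rw [one_mul]; exact huU s t hs hst ht⟩
    have hq0 : 0 < 1 / q := by positivity
    have hκ := constK_sub_one_nonneg hγq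
    have h0 : (0 : ℝ) ∈ Set.Icc (0 : ℝ) 1 := by simp
    have h1 : (1 : ℝ) ∈ Set.Icc (0 : ℝ) 1 := by simp
    have hV01 : 0 ≤ V 1 - V 0 := sub_nonneg.2 (hV h0 h1 zero_le_one)
    have hU01 : 0 ≤ U 1 - U 0 := sub_nonneg.2 (hU h0 h1 zero_le_one)
    set B' := F * B + (constK (1 / q + γ) - 1) * (1 * B * (V 1 - V 0) ^ (1 / q)) with hB'
    have hB'0 : 0 ≤ B' := by positivity
    refine ⟨U, B' * (U 1 - U 0) ^ (γ - α), by positivity, hU, fun s t hs hst ht => ?_⟩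
    have hsI : s ∈ Set.Icc (0 : ℝ) 1 := ⟨hs, hst.trans ht⟩
    have htI : t ∈ Set.Icc (0 : ℝ) 1 := ⟨hs.trans hst, ht⟩
    have hsub : Set.Icc s t ⊆ Set.Icc 0 1 := Set.Icc_subset_Icc hs ht
    have key := (hJ s t hs hst ht i j).young hst hq0 (by linarith) hγq zero_le_one hB
      (hV.mono hsub) (hU.mono hsub)
      (fun a b ha hab hb => by
        rw [one_mul]; exact hvV a b (hs.trans ha) hab (hb.trans ht))
      (fun a b ha hab hb => huU a b (hs.trans ha) hab (hb.trans ht))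
    have hVst : 0 ≤ V t - V s := sub_nonneg.2 (hV hsI htI hst)
    have hUst : 0 ≤ U t - U s := sub_nonneg.2 (hU hsI htI hst)
    have hVle : V t - V s ≤ V 1 - V 0 := by
      have := hV h0 hsI hs
      have := hV htI h1 ht
      linarith
    have hUle : U t - U s ≤ U 1 - U 0 := by
      have := hU h0 hsI hs
      have := hU htI h1 ht
      linarith
    have h2 : |J t i j - J s i j| ≤ B' * (U t - U s) ^ γ := by
      have e1 := abs_sub_le (J t i j - J s i j) (f (y s) i j * (x t j - x s j)) 0
      rw [sub_zero, sub_zero, abs_mul] at e1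
      have e2 : |f (y s) i j| * |x t j - x s j| ≤ F * (B * (U t - U s) ^ γ) :=
        mul_le_mul (hF _ _ _) (huU s t hs hst ht) (abs_nonneg _) hF0
      have e3 : (constK (1 / q + γ) - 1) * (1 * B * ((V t - V s) ^ (1 / q) * (U t - U s) ^ γ)) ≤
          (constK (1 / q + γ) - 1) * (1 * B * ((V 1 - V 0) ^ (1 / q) * (U t - U s) ^ γ)) := by
        have := Real.rpow_le_rpow hVst hVle hq0.le
        gcongr
      rw [hB']
      calc _ ≤ _ := e1
        _ ≤ (constK (1 / q + γ) - 1) * (1 * B * ((V 1 - V 0) ^ (1 / q) * (U t - U s) ^ γ)) +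
            F * (B * (U t - U s) ^ γ) := add_le_add (key.trans e3) e2
        _ = _ := by ring
    exact h2.trans (abs_le_mul_rpow_of_le (by linarith) hγα hUst hU01 hUle hB'0)
  choose U B hB hU hJU using hij
  have hmono : ∀ s t, 0 ≤ s → s ≤ t → t ≤ 1 → ∀ i j, 0 ≤ U i j t - U i j s :=
    fun s t hs hst ht i j => sub_nonneg.2
      (hU i j ⟨hs, hst.trans ht⟩ ⟨hs.trans hst, ht⟩ hst)
  -- Summing the controls of the entries gives a single one for all coordinates.
  refine ⟨fun t => ∑ i, ∑ j, U i j t, ∑ i, ∑ j, B i j,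
    sum_nonneg fun i _ => sum_nonneg fun j _ => hB i j,
    fun s hs t ht hst => sum_le_sum fun i _ => sum_le_sum fun j _ => hU i j hs ht hst,
    fun s t hs hst ht => ?_⟩
  have hdiff : ∑ i, ∑ j, U i j t - ∑ i, ∑ j, U i j s = ∑ i, ∑ j, (U i j t - U i j s) := by
    simp only [sum_sub_distrib]
  simp only
  rw [hdiff]
  have hnn : 0 ≤ ∑ i, ∑ j, (U i j t - U i j s) :=
    sum_nonneg fun i _ => sum_nonneg fun j _ => hmono s t hs hst ht i j
  have hBnn : 0 ≤ ∑ i, ∑ j, B i j := sum_nonneg fun i _ => sum_nonneg fun j _ => hB i j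
  refine (pi_norm_le_iff_of_nonneg (by positivity)).2 fun i => ?_
  rw [Pi.sub_apply, hyJ s t hs hst ht i, Real.norm_eq_abs]
  have hone : ∀ j, U i j t - U i j s ≤ ∑ i, ∑ j, (U i j t - U i j s) := fun j =>
    (single_le_sum (f := fun j => U i j t - U i j s) (fun j _ => hmono s t hs hst ht i j)
      (mem_univ j)).trans
    (single_le_sum (f := fun i => ∑ j, (U i j t - U i j s))
      (fun i _ => sum_nonneg fun j _ => hmono s t hs hst ht i j) (mem_univ i))
  calc _ ≤ ∑ j, B i j * (∑ i, ∑ j, (U i j t - U i j s)) ^ α := by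
        refine (abs_sum_le_sum_abs _ _).trans (sum_le_sum fun j _ => ?_)
        refine (hJU i j s t hs hst ht).trans (mul_le_mul_of_nonneg_left ?_ (hB i j))
        exact Real.rpow_le_rpow (hmono s t hs hst ht i j) (hone j) (by linarith)
    _ = (∑ j, B i j) * (∑ i, ∑ j, (U i j t - U i j s)) ^ α := by rw [sum_mul]
    _ ≤ _ := by
        refine mul_le_mul_of_nonneg_right ?_ (by positivity)
        exact single_le_sum (f := fun i => ∑ j, B i j)
          (fun i _ => sum_nonneg fun j _ => hB i j) (mem_univ i)

/-- First-order expansion of a solution whose increments are controlled. -/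
theorem IsYoungSolution.norm_sub_sub_mulVec_le {α C Λ : ℝ} (hα : 1 / 2 < α) (hC : 0 ≤ C)
    {f : (Fin d → ℝ) → Matrix (Fin d) (Fin h) ℝ} (hΛ0 : 0 ≤ Λ)
    (hΛ : ∀ z w i j, |f z i j - f w i j| ≤ Λ * ‖z - w‖) {x : ℝ → Fin h → ℝ}
    (hx : ∀ s ∈ Set.Icc (0 : ℝ) 1, ∀ t ∈ Set.Icc (0 : ℝ) 1, ‖x t - x s‖ ≤ C * |t - s| ^ α)
    {y₀ : Fin d → ℝ} {y : ℝ → Fin d → ℝ} (hy : IsYoungSolution f x y₀ y)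
    {V : ℝ → ℝ} {B s t : ℝ} (hB : 0 ≤ B) (hs : 0 ≤ s) (hst : s ≤ t) (ht : t ≤ 1)
    (hV : MonotoneOn V (Set.Icc s t))
    (hyV : ∀ a b, s ≤ a → a ≤ b → b ≤ t → ‖y b - y a‖ ≤ B * (V b - V a) ^ α) :
    ‖y t - y s - (f (y s)).mulVec (x t - x s)‖ ≤
      (constK (2 * α) - 1) * (h * Λ * C) * B * ((V t - V s) ^ α * (t - s) ^ α) := by
  obtain ⟨J, hJ, hyJ⟩ := hy.exists_increments
  have hκ := constK_sub_one_nonneg (by linarith : 1 < 2 * α)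
  have hVst : 0 ≤ V t - V s :=
    sub_nonneg.2 (hV (Set.left_mem_Icc.2 hst) (Set.right_mem_Icc.2 hst) hst)
  have hts : 0 ≤ t - s := sub_nonneg.2 hst
  refine (pi_norm_le_iff_of_nonneg (by positivity)).2 fun i => ?_
  have hone : ∀ j, |(J t i j - J s i j) - f (y s) i j * (x t j - x s j)| ≤
      (constK (2 * α) - 1) * (Λ * B * C * ((V t - V s) ^ α * (t - s) ^ α)) := by
    intro j
    have := (hJ s t hs hst ht i j).young hst (by linarith) (by linarith) (by linarith : 1 < α + α)
      (mul_nonneg hΛ0 hB) hC hV (monotone_id.monotoneOn _)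
      (fun a b ha hab hb => (hΛ _ _ i j).trans (by
        rw [mul_assoc]
        exact mul_le_mul_of_nonneg_left (hyV a b ha hab hb) hΛ0))
      (fun a b ha hab hb => by
        have := hx a ⟨hs.trans ha, (hab.trans hb).trans ht⟩ b
          ⟨(hs.trans ha).trans hab, hb.trans ht⟩
        rw [abs_of_nonneg (sub_nonneg.2 hab)] at this
        exact (norm_le_pi_norm (x b - x a) j).trans this)
    rwa [← two_mul] at this
  have heq : (y t - y s - (f (y s)).mulVec (x t - x s)) i =
      ∑ j, ((J t i j - J s i j) - f (y s) i j * (x t j - x s j)) := by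
    rw [sum_sub_distrib, ← hyJ s t hs hst ht i]
    rfl
  rw [heq, Real.norm_eq_abs]
  calc _ ≤ ∑ _j : Fin h, (constK (2 * α) - 1) * (Λ * B * C * ((V t - V s) ^ α * (t - s) ^ α)) :=
        (abs_sum_le_sum_abs _ _).trans (sum_le_sum fun j _ => hone j)
    _ = _ := by rw [sum_const, card_univ, Fintype.card_fin, nsmul_eq_mul]; ring

/-- In the expansion error the power of V is bounded by its total increment, leaving the factor (t −
s)^α. The constant depends on y and serves only as the finite start for absorption. -/
theorem IsYoungSolution.exists_holder {α C F Λ : ℝ} (hα : 1 / 2 < α) (hC : 0 ≤ C)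
    {f : (Fin d → ℝ) → Matrix (Fin d) (Fin h) ℝ} (hF0 : 0 ≤ F) (hF : ∀ z i j, |f z i j| ≤ F)
    (hΛ0 : 0 ≤ Λ) (hΛ : ∀ z w i j, |f z i j - f w i j| ≤ Λ * ‖z - w‖) {x : ℝ → Fin h → ℝ}
    (hx : ∀ s ∈ Set.Icc (0 : ℝ) 1, ∀ t ∈ Set.Icc (0 : ℝ) 1, ‖x t - x s‖ ≤ C * |t - s| ^ α)
    {y₀ : Fin d → ℝ} {y : ℝ → Fin d → ℝ} (hy : IsYoungSolution f x y₀ y) :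
    ∃ H, 0 ≤ H ∧ ∀ s t, 0 ≤ s → s ≤ t → t ≤ 1 → ‖y t - y s‖ ≤ H * (t - s) ^ α := by
  obtain ⟨V, B, hB, hV, hyV⟩ := hy.exists_control hα hC hF0 hF hx
  have hκ := constK_sub_one_nonneg (by linarith : 1 < 2 * α)
  have h0 : (0 : ℝ) ∈ Set.Icc (0 : ℝ) 1 := by simp
  have h1 : (1 : ℝ) ∈ Set.Icc (0 : ℝ) 1 := by simp
  have hV01 : 0 ≤ V 1 - V 0 := sub_nonneg.2 (hV h0 h1 zero_le_one)
  refine ⟨(constK (2 * α) - 1) * (h * Λ * C) * B * (V 1 - V 0) ^ α + h * F * C, by positivity,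
    fun s t hs hst ht => ?_⟩
  have hsI : s ∈ Set.Icc (0 : ℝ) 1 := ⟨hs, hst.trans ht⟩
  have htI : t ∈ Set.Icc (0 : ℝ) 1 := ⟨hs.trans hst, ht⟩
  have hts : 0 ≤ t - s := sub_nonneg.2 hst
  have e1 := hy.norm_sub_sub_mulVec_le hα hC hΛ0 hΛ hx hB hs hst ht
    (hV.mono (Set.Icc_subset_Icc hs ht))
    (fun a b ha hab hb => hyV a b (hs.trans ha) hab (hb.trans ht))
  have hVst : 0 ≤ V t - V s := sub_nonneg.2 (hV hsI htI hst)
  have hVle : V t - V s ≤ V 1 - V 0 := by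
    have := hV h0 hsI hs
    have := hV htI h1 ht
    linarith
  have e2 := norm_mulVec_le hF0 (hF (y s)) (x t - x s)
  have e3 := hx s hsI t htI
  rw [abs_of_nonneg hts] at e3
  have e4 := Real.rpow_le_rpow hVst hVle (by linarith : 0 ≤ α)
  calc ‖y t - y s‖ ≤ ‖y t - y s - (f (y s)).mulVec (x t - x s)‖ +
        ‖(f (y s)).mulVec (x t - x s)‖ := by
          simpa using norm_add_le (y t - y s - (f (y s)).mulVec (x t - x s))
            ((f (y s)).mulVec (x t - x s))
    _ ≤ (constK (2 * α) - 1) * (h * Λ * C) * B * ((V 1 - V 0) ^ α * (t - s) ^ α) +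
        h * F * (C * (t - s) ^ α) := by
          refine add_le_add (e1.trans ?_) (e2.trans ?_) <;> gcongr
    _ = _ := by ring

/-- On intervals of length at most l the remainder reproduces at most half of the Hölder constant,
so absorption gives the fixed point hFC / (1 − 1/2). -/
theorem IsYoungSolution.norm_sub_le_local {α C F Λ : ℝ} (hα : 1 / 2 < α) (hC : 0 ≤ C)
    {f : (Fin d → ℝ) → Matrix (Fin d) (Fin h) ℝ} (hF0 : 0 ≤ F) (hF : ∀ z i j, |f z i j| ≤ F)
    (hΛ0 : 0 ≤ Λ) (hΛ : ∀ z w i j, |f z i j - f w i j| ≤ Λ * ‖z - w‖) {x : ℝ → Fin h → ℝ}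
    (hx : ∀ s ∈ Set.Icc (0 : ℝ) 1, ∀ t ∈ Set.Icc (0 : ℝ) 1, ‖x t - x s‖ ≤ C * |t - s| ^ α)
    {y₀ : Fin d → ℝ} {y : ℝ → Fin d → ℝ} (hy : IsYoungSolution f x y₀ y) {l : ℝ} (hl0 : 0 ≤ l)
    (hl : (constK (2 * α) - 1) * (h * Λ * C) * l ^ α ≤ 1 / 2) {s t : ℝ} (hs : 0 ≤ s)
    (hst : s ≤ t) (ht : t ≤ 1) (hstl : t - s ≤ l) :
    ‖y t - y s‖ ≤ 2 * (h * F * C) * (t - s) ^ α := by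
  obtain ⟨H₀, hH₀, hyH₀⟩ := hy.exists_holder hα hC hF0 hF hΛ0 hΛ hx
  have hκ := constK_sub_one_nonneg (by linarith : 1 < 2 * α)
  have := le_of_absorb (ι := {q : ℝ × ℝ // 0 ≤ q.1 ∧ q.1 ≤ q.2 ∧ q.2 ≤ 1 ∧ q.2 - q.1 ≤ l})
    (φ := fun q => ‖y q.1.2 - y q.1.1‖) (ψ := fun q => (q.1.2 - q.1.1) ^ α) (H₀ := H₀)
    (a := h * F * C) (r := 1 / 2)
    (fun q => Real.rpow_nonneg (sub_nonneg.2 q.2.2.1) _) hH₀ (by positivity) (by norm_num)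
    (by norm_num) (fun q => hyH₀ _ _ q.2.1 q.2.2.1 q.2.2.2.1) ?_ ⟨(s, t), hs, hst, ht, hstl⟩
  · refine this.trans (le_of_eq ?_)
    simp only
    ring
  · rintro H hH hyH ⟨⟨s, t⟩, hs, hst, ht, hstl⟩
    simp only at *
    have hts : 0 ≤ t - s := sub_nonneg.2 hst
    have e1 := hy.norm_sub_sub_mulVec_le hα hC hΛ0 hΛ hx hH hs hst ht
      (monotone_id.monotoneOn _)
      (fun a b ha hab hb => hyH ⟨(a, b), hs.trans ha, hab, hb.trans ht, by
        simp only; linarith⟩)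
    simp only [id] at e1
    have e2 := norm_mulVec_le hF0 (hF (y s)) (x t - x s)
    have e3 := hx s ⟨hs, hst.trans ht⟩ t ⟨hs.trans hst, ht⟩
    rw [abs_of_nonneg hts] at e3
    have e4 := Real.rpow_le_rpow hts hstl (by linarith : 0 ≤ α)
    calc ‖y t - y s‖ ≤ ‖y t - y s - (f (y s)).mulVec (x t - x s)‖ +
          ‖(f (y s)).mulVec (x t - x s)‖ := by
            simpa using norm_add_le (y t - y s - (f (y s)).mulVec (x t - x s))
              ((f (y s)).mulVec (x t - x s))
      _ ≤ (constK (2 * α) - 1) * (h * Λ * C) * H * (l ^ α * (t - s) ^ α) +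
          h * F * (C * (t - s) ^ α) := by
            refine add_le_add (e1.trans ?_) (e2.trans ?_) <;> gcongr
      _ = ((constK (2 * α) - 1) * (h * Λ * C) * l ^ α) * (H * (t - s) ^ α) +
          h * F * (C * (t - s) ^ α) := by ring
      _ ≤ 1 / 2 * (H * (t - s) ^ α) + h * F * (C * (t - s) ^ α) := by gcongr
      _ = _ := by ring

/-- A local Hölder estimate on the scale `1 / N` gives a global one. -/
theorem norm_sub_le_of_local {y : ℝ → Fin d → ℝ} {α H : ℝ} {N : ℕ} (hN : 0 < N)
    (hloc : ∀ s t : ℝ, 0 ≤ s → s ≤ t → t ≤ 1 → t - s ≤ 1 / N → ‖y t - y s‖ ≤ H * (t - s) ^ α)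
    {s t : ℝ} (hs : 0 ≤ s) (hst : s ≤ t) (ht : t ≤ 1) :
    ‖y t - y s‖ ≤ H * (N : ℝ) ^ (1 - α) * (t - s) ^ α := by
  have hN0 : (0 : ℝ) < N := by exact_mod_cast hN
  have hts : 0 ≤ t - s := sub_nonneg.2 hst
  -- Always N equal pieces, whatever t − s ≤ 1 is: N pieces of size ((t − s)/N)^α produce the factor
  -- N^{1−α}.
  set τ : ℕ → ℝ := fun k => s + k * ((t - s) / N) with hτ
  have hstep : ∀ k, τ (k + 1) - τ k = (t - s) / N := fun k => by simp only [hτ]; push_cast; ring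
  have hτ0 : τ 0 = s := by simp [hτ]
  have hτN : τ N = t := by simp only [hτ]; field_simp; ring
  have hmono : Monotone τ := monotone_nat_of_le_succ fun k => by
    have := hstep k
    have : 0 ≤ (t - s) / N := by positivity
    linarith
  have htel : y t - y s = ∑ k ∈ range N, (y (τ (k + 1)) - y (τ k)) := by
    rw [sum_range_sub (fun k => y (τ k)), hτ0, hτN]
  rw [htel]
  calc _ ≤ ∑ k ∈ range N, H * ((t - s) / N) ^ α := by
        refine (norm_sum_le _ _).trans (sum_le_sum fun k hk => ?_)
        have hk' := mem_range.1 hk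
        have := hloc (τ k) (τ (k + 1)) (by have := hmono (Nat.zero_le k); linarith)
          (hmono (Nat.le_succ k)) (by
            have : τ (k + 1) ≤ τ N := hmono hk'
            linarith) (by rw [hstep]; gcongr; linarith)
        rwa [hstep] at this
    _ = _ := by
        rw [sum_const, card_range, nsmul_eq_mul, Real.div_rpow hts hN0.le, Real.rpow_sub hN0,
          Real.rpow_one]
        ring

/-! ### The Euler scheme and its error on one short block. -/

theorem rpow_two_mul_le {δ τ α : ℝ} (hδ : 0 ≤ δ) (hδτ : δ ≤ τ) (hα : 0 < α) :
    δ ^ (2 * α) ≤ τ ^ α * δ ^ α := by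
  rw [two_mul, Real.rpow_add_of_nonneg hδ hα.le hα.le]
  exact mul_le_mul_of_nonneg_right (Real.rpow_le_rpow hδ hδτ hα.le) (Real.rpow_nonneg hδ _)

theorem le_rpow_one_sub_mul {δ τ α : ℝ} (hδ : 0 ≤ δ) (hδτ : δ ≤ τ) (hα : 0 < α) (hα' : α ≤ 1) :
    δ ≤ τ ^ (1 - α) * δ ^ α := by
  have h1 : δ = δ ^ (1 - α) * δ ^ α := by
    rw [← Real.rpow_add_of_nonneg hδ (by linarith) hα.le, sub_add_cancel, Real.rpow_one]
  conv_lhs => rw [h1]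
  exact mul_le_mul_of_nonneg_right (Real.rpow_le_rpow hδ hδτ (by linarith)) (Real.rpow_nonneg hδ _)

/-- First-order expansion of the solution of a perturbed linear difference equation. -/
theorem norm_sub_sub_mulVec_le_of_recursion {α A C Δ ρ : ℝ} (hα : 1 / 2 < α) (hA : 0 ≤ A)
    (hC : 0 ≤ C) (hΔ : 0 ≤ Δ) {L : ℕ} (w : ℕ → Fin d → ℝ)
    (v : ℕ → Matrix (Fin d) (Fin h) ℝ) (X : ℕ → Fin h → ℝ)
    (hX : ∀ i j, i ≤ j → j ≤ L → ‖X j - X i‖ ≤ C * (j * Δ - i * Δ) ^ α)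
    (hv : ∀ i j, i ≤ j → j ≤ L → ∀ k l, |v j k l - v i k l| ≤ A * (j * Δ - i * Δ) ^ α)
    (hw : ∀ i < L, ‖w (i + 1) - w i - (v i).mulVec (X (i + 1) - X i)‖ ≤ ρ * Δ)
    {i j : ℕ} (hij : i ≤ j) (hj : j ≤ L) :
    ‖w j - w i - (v i).mulVec (X j - X i)‖ ≤
      (constK (2 * α) - 1) * (h * A * C) * (j * Δ - i * Δ) ^ (2 * α) + ρ * (j * Δ - i * Δ) := by
  obtain ⟨N, rfl⟩ := Nat.exists_eq_add_of_le hij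
  have hY := young_discrete_mulVec hα hA hC N (fun k => v (i + k)) (fun k => X (i + k))
    (fun k => ((i + k : ℕ) : ℝ) * Δ)
    (fun a b hab _ => mul_le_mul_of_nonneg_right (by exact_mod_cast (by omega)) hΔ)
    (fun a b hab hb => hv _ _ (by omega) (by omega)) (fun a b hab hb => hX _ _ (by omega) (by omega))
  simp only [add_zero] at hY
  have htel : w (i + N) - w i = ∑ k ∈ range N, (w (i + (k + 1)) - w (i + k)) := by
    rw [sum_range_sub (fun k => w (i + k)), add_zero]
  have hr : ‖∑ k ∈ range N, (w (i + k + 1) - w (i + k) -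
      (v (i + k)).mulVec (X (i + k + 1) - X (i + k)))‖ ≤ N * (ρ * Δ) := by
    refine (norm_sum_le_of_le _ fun k hk => hw (i + k) (by have := mem_range.1 hk; omega)).trans ?_
    rw [sum_const, card_range, nsmul_eq_mul]
  have heq : w (i + N) - w i - (v i).mulVec (X (i + N) - X i) =
      (∑ k ∈ range N, (v (i + k)).mulVec (X (i + (k + 1)) - X (i + k)) -
        (v i).mulVec (X (i + N) - X i)) +
      ∑ k ∈ range N, (w (i + k + 1) - w (i + k) -
        (v (i + k)).mulVec (X (i + k + 1) - X (i + k))) := by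
    simp only [add_assoc] at htel ⊢
    rw [htel, sum_sub_distrib (fun k => w (i + (k + 1)) - w (i + k))]
    abel
  rw [heq]
  refine (norm_add_le _ _).trans (add_le_add hY (hr.trans (le_of_eq ?_)))
  push_cast
  ring

/-- Distinct grid points are at least Δ apart. The constant degenerates with the mesh, which is
harmless because absorption forgets it. -/
theorem exists_holder_of_finite (w : ℕ → Fin d → ℝ) {Δ α : ℝ} (hΔ : 0 < Δ) (hα : 0 ≤ α) (L : ℕ) :
    ∃ H, 0 ≤ H ∧ ∀ i j : ℕ, i ≤ j → j ≤ L → ‖w j - w i‖ ≤ H * (j * Δ - i * Δ) ^ α := by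
  have hΔα : 0 < Δ ^ α := Real.rpow_pos_of_pos hΔ _
  set T := ∑ i ∈ range (L + 1), ∑ j ∈ range (L + 1), ‖w j - w i‖ with hT
  have hT0 : 0 ≤ T := sum_nonneg fun i _ => sum_nonneg fun j _ => norm_nonneg _
  refine ⟨T / Δ ^ α, by positivity, fun i j hij hj => ?_⟩
  rcases hij.eq_or_lt with rfl | hlt
  · rw [sub_self, norm_zero, sub_self]
    positivity
  · have h1 : ‖w j - w i‖ ≤ T :=
      (single_le_sum (f := fun j => ‖w j - w i‖) (fun j _ => norm_nonneg _)
        (mem_range.2 (by omega : j < L + 1))).trans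
      (single_le_sum (f := fun i => ∑ j ∈ range (L + 1), ‖w j - w i‖)
        (fun i _ => sum_nonneg fun j _ => norm_nonneg _) (mem_range.2 (by omega : i < L + 1)))
    have h2 : Δ ≤ j * Δ - i * Δ := by
      have : (i : ℝ) + 1 ≤ j := by exact_mod_cast hlt
      nlinarith
    have h3 := Real.rpow_le_rpow hΔ.le h2 hα
    calc _ ≤ T := h1
      _ = T / Δ ^ α * Δ ^ α := by field_simp
      _ ≤ _ := by gcongr

theorem mul_sub_mul_mem {Δ : ℝ} (hΔ : 0 ≤ Δ) {i j L : ℕ} (hij : i ≤ j) (hj : j ≤ L) :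
    0 ≤ (j : ℝ) * Δ - i * Δ ∧ (j : ℝ) * Δ - i * Δ ≤ L * Δ := by
  have h1 : (i : ℝ) ≤ j := by exact_mod_cast hij
  have h2 : (j : ℝ) ≤ L := by exact_mod_cast hj
  have h3 : (0 : ℝ) ≤ i := i.cast_nonneg
  constructor <;> nlinarith

/-- On a short interval the Euler scheme is Hölder, uniformly in the mesh. -/
theorem euler_norm_sub_le {α C F Λ Δ : ℝ} (hα : 1 / 2 < α) (hC : 0 ≤ C) (hΔ : 0 < Δ)
    {f : (Fin d → ℝ) → Matrix (Fin d) (Fin h) ℝ} (hF0 : 0 ≤ F) (hF : ∀ z i j, |f z i j| ≤ F)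
    (hΛ0 : 0 ≤ Λ) (hΛ : ∀ z w i j, |f z i j - f w i j| ≤ Λ * ‖z - w‖) {L : ℕ}
    {X : ℕ → Fin h → ℝ} {Z : ℕ → Fin d → ℝ}
    (hX : ∀ i j, i ≤ j → j ≤ L → ‖X j - X i‖ ≤ C * (j * Δ - i * Δ) ^ α)
    (hZ : ∀ i < L, Z (i + 1) = Z i + (f (Z i)).mulVec (X (i + 1) - X i))
    (hL : (constK (2 * α) - 1) * (h * Λ * C) * (L * Δ) ^ α ≤ 1 / 2) {i j : ℕ} (hij : i ≤ j)
    (hj : j ≤ L) : ‖Z j - Z i‖ ≤ 2 * (h * F * C) * (j * Δ - i * Δ) ^ α := by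
  obtain ⟨H₀, hH₀, hZH₀⟩ := exists_holder_of_finite Z hΔ (by linarith : 0 ≤ α) L
  have hκ := constK_sub_one_nonneg (by linarith : 1 < 2 * α)
  have := le_of_absorb (ι := {q : ℕ × ℕ // q.1 ≤ q.2 ∧ q.2 ≤ L})
    (φ := fun q => ‖Z q.1.2 - Z q.1.1‖) (ψ := fun q => (q.1.2 * Δ - q.1.1 * Δ) ^ α) (H₀ := H₀)
    (a := h * F * C) (r := 1 / 2)
    (fun q => Real.rpow_nonneg (mul_sub_mul_mem hΔ.le q.2.1 q.2.2).1 _) hH₀ (by positivity)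
    (by norm_num) (by norm_num) (fun q => hZH₀ _ _ q.2.1 q.2.2) ?_ ⟨(i, j), hij, hj⟩
  · refine this.trans (le_of_eq ?_)
    simp only
    ring
  · rintro H hH hZH ⟨⟨i, j⟩, hij, hj⟩
    simp only at *
    have hδ := mul_sub_mul_mem hΔ.le hij hj
    have e1 := norm_sub_sub_mulVec_le_of_recursion hα (mul_nonneg hΛ0 hH) hC hΔ.le (ρ := 0) Z
      (fun k => f (Z k)) X hX (fun a b hab hb k l => (hΛ _ _ k l).trans (by
        rw [mul_assoc]
        exact mul_le_mul_of_nonneg_left (hZH ⟨(a, b), hab, hb⟩) hΛ0))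
      (fun k hk => by rw [hZ k hk]; simp) hij hj
    have e2 := norm_mulVec_le hF0 (hF (Z i)) (X j - X i)
    have e3 := hX i j hij hj
    have e4 := rpow_two_mul_le hδ.1 hδ.2 (by linarith : 0 < α)
    calc ‖Z j - Z i‖ ≤ ‖Z j - Z i - (f (Z i)).mulVec (X j - X i)‖ +
          ‖(f (Z i)).mulVec (X j - X i)‖ := by
            simpa using norm_add_le (Z j - Z i - (f (Z i)).mulVec (X j - X i))
              ((f (Z i)).mulVec (X j - X i))
      _ ≤ ((constK (2 * α) - 1) * (h * (Λ * H) * C) * ((L * Δ) ^ α * (j * Δ - i * Δ) ^ α) + 0) +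
          h * F * (C * (j * Δ - i * Δ) ^ α) := by
            refine add_le_add (e1.trans ?_) (e2.trans ?_)
            · rw [zero_mul]; gcongr
            · gcongr
      _ = ((constK (2 * α) - 1) * (h * Λ * C) * (L * Δ) ^ α) * (H * (j * Δ - i * Δ) ^ α) +
          h * F * (C * (j * Δ - i * Δ) ^ α) := by ring
      _ ≤ 1 / 2 * (H * (j * Δ - i * Δ) ^ α) + h * F * (C * (j * Δ - i * Δ) ^ α) := by
            have := hδ.1
            gcongr
      _ = _ := by ring

/-- Propagation of the error of the Euler scheme over a short interval. -/
theorem euler_error_block {α C Λ Θ η Δ g : ℝ} (hα : 1 / 2 < α) (hα' : α ≤ 1) (hC : 0 ≤ C)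
    (hΔ : 0 < Δ) (hη : 0 ≤ η) (hg : 0 ≤ g) (hΘ0 : 0 ≤ Θ)
    {f : (Fin d → ℝ) → Matrix (Fin d) (Fin h) ℝ}
    (hΛ0 : 0 ≤ Λ) (hΛ : ∀ z w i j, |f z i j - f w i j| ≤ Λ * ‖z - w‖)
    (hΘ : ∀ y z y' z' (ξ : ℝ), ‖y - y'‖ ≤ ξ → ‖z - z'‖ ≤ ξ → ∀ i j,
      |(f y i j - f z i j) - (f y' i j - f z' i j)| ≤
        Λ * ‖(y - z) - (y' - z')‖ + Θ * ξ * ‖y - z‖) {L : ℕ}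
    {X : ℕ → Fin h → ℝ} {Y Z : ℕ → Fin d → ℝ}
    (hX : ∀ i j, i ≤ j → j ≤ L → ‖X j - X i‖ ≤ C * (j * Δ - i * Δ) ^ α)
    (hZ : ∀ i < L, Z (i + 1) = Z i + (f (Z i)).mulVec (X (i + 1) - X i))
    (hY : ∀ i < L, ‖Y (i + 1) - Y i - (f (Y i)).mulVec (X (i + 1) - X i)‖ ≤ g * Δ)
    (hYη : ∀ i j : ℕ, i ≤ j → j ≤ L → ‖Y j - Y i‖ ≤ η * (j * Δ - i * Δ) ^ α)
    (hZη : ∀ i j : ℕ, i ≤ j → j ≤ L → ‖Z j - Z i‖ ≤ η * (j * Δ - i * Δ) ^ α) {w r b' : ℝ}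
    (hw : (L * Δ) ^ α = w)
    (hb' : b' = h * Λ * C + (constK (2 * α) - 1) * w * (h * Θ * η * C))
    (hr : r = w * (constK (2 * α) * (h * Λ * C) + (constK (2 * α) - 1) * w * (h * Θ * η * C)))
    (hr1 : r < 1) {j : ℕ} (hj : j ≤ L) :
    ‖Y j - Z j‖ ≤ ‖Y 0 - Z 0‖ + 1 / (1 - r) * (g * (L * Δ) + w * b' * ‖Y 0 - Z 0‖) := by
  have hκ := constK_sub_one_nonneg (by linarith : 1 < 2 * α)
  set κ := constK (2 * α) - 1 with hκd
  have hK : constK (2 * α) = 1 + κ := by rw [hκd]; ring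
  have hα0 : 0 < α := by linarith
  have hLΔ : 0 ≤ L * Δ := by positivity
  have hw0 : 0 ≤ w := hw ▸ Real.rpow_nonneg hLΔ _
  set e : ℕ → Fin d → ℝ := fun k => Y k - Z k with he
  set e₀ := ‖e 0‖ with he₀
  have he₀0 : 0 ≤ e₀ := norm_nonneg _
  have hb'0 : 0 ≤ b' := by rw [hb']; positivity
  have hr0 : 0 ≤ r := by rw [hr, hK]; positivity
  obtain ⟨H₀, hH₀, heH₀⟩ := exists_holder_of_finite e hΔ hα0.le L
  -- Absorption for the Hölder seminorm E of the error: Young's inequality reproduces E with factor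
  -- r, plus the local errors and the initial error e₀ amplified by b'.
  have hmain := le_of_absorb (ι := {q : ℕ × ℕ // q.1 ≤ q.2 ∧ q.2 ≤ L})
    (φ := fun q => ‖e q.1.2 - e q.1.1‖) (ψ := fun q => (q.1.2 * Δ - q.1.1 * Δ) ^ α) (H₀ := H₀)
    (a := g * (L * Δ) ^ (1 - α) + b' * e₀) (r := r)
    (fun q => Real.rpow_nonneg (mul_sub_mul_mem hΔ.le q.2.1 q.2.2).1 _) hH₀ (by positivity)
    hr0 hr1 (fun q => heH₀ _ _ q.2.1 q.2.2) ?_ ⟨(0, j), Nat.zero_le _, hj⟩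
  · simp only [Nat.cast_zero, zero_mul, sub_zero] at hmain
    have hδ := mul_sub_mul_mem hΔ.le (Nat.zero_le j) hj
    simp only [Nat.cast_zero, zero_mul, sub_zero] at hδ
    have h1r : 0 < 1 - r := by linarith
    have h2 : (j * Δ) ^ α ≤ w := hw ▸ Real.rpow_le_rpow hδ.1 hδ.2 hα0.le
    have h3 : (L * Δ) ^ (1 - α) * w = L * Δ := by
      rw [← hw, ← Real.rpow_add_of_nonneg hLΔ (by linarith) hα0.le, sub_add_cancel, Real.rpow_one]
    calc ‖Y j - Z j‖ ≤ ‖e 0‖ + ‖e j - e 0‖ := by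
          simpa using norm_add_le (e 0) (e j - e 0)
      _ ≤ e₀ + (g * (L * Δ) ^ (1 - α) + b' * e₀) / (1 - r) * w := by
          refine add_le_add le_rfl (hmain.trans ?_)
          gcongr
      _ = e₀ + 1 / (1 - r) * (g * ((L * Δ) ^ (1 - α) * w) + w * b' * e₀) := by ring
      _ = _ := by rw [h3]
  · rintro E hE heE ⟨⟨i, j⟩, hij, hj⟩
    simp only at *
    have hδ := mul_sub_mul_mem hΔ.le hij hj
    set δ := (j : ℝ) * Δ - i * Δ with hδd
    have hδα : 0 ≤ δ ^ α := Real.rpow_nonneg hδ.1 _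
    -- A bound for the supremum of the error on the block, from its initial value and its seminorm.
    set a₀ := e₀ + E * w with ha₀
    have hsup : ∀ k ≤ L, ‖e k‖ ≤ a₀ := fun k hk => by
      have h1 := heE ⟨(0, k), Nat.zero_le _, hk⟩
      have hδk := mul_sub_mul_mem hΔ.le (Nat.zero_le k) hk
      have h2 := hw ▸ Real.rpow_le_rpow hδk.1 hδk.2 hα0.le
      have h3 : ‖e k‖ ≤ ‖e 0‖ + ‖e k - e 0‖ := by simpa using norm_add_le (e 0) (e k - e 0)
      have h4 := mul_le_mul_of_nonneg_left h2 hE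
      simp only at h1
      linarith
    have ha₀0 : 0 ≤ a₀ := by positivity
    have hv : ∀ a b : ℕ, a ≤ b → b ≤ L → ∀ k l,
        |(f (Y b) - f (Z b)) k l - (f (Y a) - f (Z a)) k l| ≤
          (Λ * E + Θ * η * a₀) * (b * Δ - a * Δ) ^ α := by
      intro a b hab hb k l
      have h1 := hΘ (Y b) (Z b) (Y a) (Z a) _ (hYη a b hab hb) (hZη a b hab hb) k l
      have h2 := heE ⟨(a, b), hab, hb⟩
      have h3 := hsup b hb
      have h4 : 0 ≤ ((b : ℝ) * Δ - a * Δ) ^ α :=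
        Real.rpow_nonneg (mul_sub_mul_mem hΔ.le hab hb).1 _
      simp only [he] at h2 h3
      calc _ ≤ _ := h1
        _ ≤ Λ * (E * ((b : ℝ) * Δ - a * Δ) ^ α) +
            Θ * (η * ((b : ℝ) * Δ - a * Δ) ^ α) * a₀ := by gcongr
        _ = _ := by ring
    have e1 := norm_sub_sub_mulVec_le_of_recursion hα
      (by positivity : 0 ≤ Λ * E + Θ * η * a₀) hC hΔ.le (ρ := g) e
      (fun k => f (Y k) - f (Z k)) X hX hv
      (fun k hk => by
        have : e (k + 1) - e k - (f (Y k) - f (Z k)).mulVec (X (k + 1) - X k) =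
            Y (k + 1) - Y k - (f (Y k)).mulVec (X (k + 1) - X k) := by
          simp only [he, Matrix.sub_mulVec, hZ k hk]
          abel
        rw [this]
        exact hY k hk) hij hj
    have e2 : ‖(f (Y i) - f (Z i)).mulVec (X j - X i)‖ ≤ h * (Λ * a₀) * (C * δ ^ α) := by
      refine (norm_mulVec_le (by positivity : 0 ≤ Λ * a₀) (fun k l => (hΛ _ _ k l).trans
        (mul_le_mul_of_nonneg_left (hsup i (hij.trans hj)) hΛ0)) _).trans ?_
      have := hX i j hij hj
      gcongr
    have e4 := rpow_two_mul_le hδ.1 hδ.2 hα0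
    have e5 := le_rpow_one_sub_mul hδ.1 hδ.2 hα0 hα'
    rw [hw] at e4
    calc ‖e j - e i‖ ≤ ‖e j - e i - (f (Y i) - f (Z i)).mulVec (X j - X i)‖ +
          ‖(f (Y i) - f (Z i)).mulVec (X j - X i)‖ := by
            simpa using norm_add_le (e j - e i - (f (Y i) - f (Z i)).mulVec (X j - X i))
              ((f (Y i) - f (Z i)).mulVec (X j - X i))
      _ ≤ (κ * (h * (Λ * E + Θ * η * a₀) * C) * (w * δ ^ α) +
            g * ((L * Δ) ^ (1 - α) * δ ^ α)) + h * (Λ * a₀) * (C * δ ^ α) := by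
            refine add_le_add (e1.trans ?_) e2
            gcongr
      _ = _ := by rw [hb', hr, hK, ha₀]; ring

/-! ### Gronwall over blocks and comparison of growth rates. -/

/-- Discrete Gronwall inequality over `R` blocks of `L` steps each. -/
theorem gronwall_blocks {e : ℕ → ℝ} {B Γ : ℝ} (hB : 0 ≤ B) (hΓ : 0 ≤ Γ) {R L : ℕ} (hL : 0 < L)
    (h0 : e 0 = 0) (hstep : ∀ j < R, ∀ i ≤ L, e (j * L + i) ≤ (1 + Γ) * e (j * L) + B) {k : ℕ}
    (hk : k ≤ R * L) : Γ * e k ≤ B * ((1 + Γ) ^ R - 1) := by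
  have hblock : ∀ j ≤ R, Γ * e (j * L) ≤ B * ((1 + Γ) ^ j - 1) := by
    intro j
    induction j with
    | zero => simp [h0]
    | succ j ih =>
      intro hj
      have h1 := ih (by omega)
      have h2 := mul_le_mul_of_nonneg_left (hstep j (by omega) L le_rfl) hΓ
      rw [show (j + 1) * L = j * L + L by ring, pow_succ]
      nlinarith
  have hpow : ∀ j ≤ R, B * ((1 + Γ) ^ j - 1) ≤ B * ((1 + Γ) ^ R - 1) := fun j hj => by
    have := pow_le_pow_right₀ (by linarith : 1 ≤ 1 + Γ) hj
    gcongr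
  rcases hk.eq_or_lt with rfl | hlt
  · exact hblock R le_rfl
  -- An index inside a block: full blocks up to k / L, then one application of `hstep` with offset k
  -- % L.
  · have hj : k / L < R := (Nat.div_lt_iff_lt_mul hL).2 hlt
    have h1 := hblock (k / L) hj.le
    have h2 := mul_le_mul_of_nonneg_left (hstep (k / L) hj (k % L) (Nat.mod_lt k hL).le) hΓ
    rw [Nat.div_add_mod'] at h2
    have h3 := hpow (k / L + 1) hj
    rw [pow_succ] at h3
    nlinarith

/-- By convexity (e^X − 1)/X is nondecreasing. -/
theorem exp_secant {X Y : ℝ} (hX : 0 < X) (hXY : X ≤ Y) :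
    (Real.exp X - 1) * Y ≤ (Real.exp Y - 1) * X := by
  have hY : 0 < Y := hX.trans_le hXY
  have h := convexOn_exp.2 (Set.mem_univ 0) (Set.mem_univ Y)
    (sub_nonneg.2 ((div_le_one hY).2 hXY)) (div_nonneg hX.le hY.le) (by ring)
  simp only [smul_eq_mul, mul_zero, zero_add, Real.exp_zero, mul_one] at h
  rw [div_mul_cancel₀ _ hY.ne'] at h
  have h2 := mul_le_mul_of_nonneg_right h hY.le
  have h3 : (1 - X / Y + X / Y * Real.exp Y) * Y = Y - X + X * Real.exp Y := by field_simp
  rw [h3] at h2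
  linarith

/-- By convexity (1 − e^{−X})/X is nonincreasing; this bounds the loss in the secant slope when the
exponent is enlarged. -/
theorem exp_secant_shift {X Y : ℝ} (hX : 0 < X) (hXY : X ≤ Y) :
    (Real.exp Y - 1) * X ≤ Y * (Real.exp X - 1) * Real.exp (Y - X) := by
  have hY : 0 < Y := hX.trans_le hXY
  have h := convexOn_exp.2 (Set.mem_univ 0) (Set.mem_univ (-Y))
    (sub_nonneg.2 ((div_le_one hY).2 hXY)) (div_nonneg hX.le hY.le) (by ring)
  simp only [smul_eq_mul, mul_zero, zero_add, Real.exp_zero, mul_one] at h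
  rw [mul_neg, div_mul_cancel₀ _ hY.ne'] at h
  have h2 := mul_le_mul_of_nonneg_right h hY.le
  have h3 : (1 - X / Y + X / Y * Real.exp (-Y)) * Y = Y - X + X * Real.exp (-Y) := by field_simp
  rw [h3] at h2
  have h4 := mul_le_mul_of_nonneg_right h2 (Real.exp_pos Y).le
  have h5 : Real.exp (-Y) * Real.exp Y = 1 := by rw [← Real.exp_add]; simp
  have h6 : Real.exp (-X) * Real.exp Y = Real.exp (Y - X) := by
    rw [← Real.exp_add]; congr 1; ring
  have h7 : Real.exp X * Real.exp (Y - X) = Real.exp Y := by rw [← Real.exp_add]; simp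
  have h8 : Real.exp (-X) * Y * Real.exp Y = Real.exp (Y - X) * Y := by rw [← h6]; ring
  have h9 : (Y - X + X * Real.exp (-Y)) * Real.exp Y = (Y - X) * Real.exp Y + X := by
    rw [add_mul, mul_assoc X, h5, mul_one]
  rw [h8, h9] at h4
  have h10 : Y * (Real.exp X - 1) * Real.exp (Y - X) =
      Y * Real.exp Y - Y * Real.exp (Y - X) := by rw [← h7]; ring
  rw [h10]
  linarith

/-- Convexity reduces this to the endpoints. The factor 1.35 is chosen so that 4/3 · 1.35 = 1.8, the
rate in the second case of `growth_comparison`. -/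
theorem exp_le_linear {μ : ℝ} (h1 : 1 ≤ μ) (h10 : μ ≤ 10) :
    Real.exp (0.21 * μ) ≤ 1.35 * μ := by
  have e1 : Real.exp 0.21 ≤ 1.35 := by
    have := Real.exp_bound' (x := 0.21) (by norm_num) (by norm_num) (n := 3) (by norm_num)
    refine this.trans ?_
    norm_num [sum_range_succ, Nat.factorial]
  have e2 : Real.exp 2.1 ≤ 13.5 := by
    have h := Real.exp_one_lt_d9
    have h3 : Real.exp 2.1 ≤ Real.exp (1 + 1 + 0.21) := Real.exp_le_exp.2 (by norm_num)
    rw [Real.exp_add, Real.exp_add] at h3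
    have hp := Real.exp_pos 1
    calc Real.exp 2.1 ≤ _ := h3
      _ ≤ 2.72 * 2.72 * 1.35 := by gcongr <;> linarith
      _ ≤ 13.5 := by norm_num
  have h := convexOn_exp.2 (Set.mem_univ (0.21 : ℝ)) (Set.mem_univ (2.1 : ℝ))
    (by linarith : 0 ≤ (10 - μ) / 9) (by linarith : 0 ≤ (μ - 1) / 9) (by ring)
  simp only [smul_eq_mul] at h
  have h4 : (10 - μ) / 9 * 0.21 + (μ - 1) / 9 * 2.1 = 0.21 * μ := by ring
  rw [h4] at h
  have h5 := mul_le_mul_of_nonneg_left e1 (by linarith : 0 ≤ (10 - μ) / 9)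
  have h6 := mul_le_mul_of_nonneg_left e2 (by linarith : 0 ≤ (μ - 1) / 9)
  nlinarith

/-- The continuous growth of the error over the whole interval is dominated by the discrete growth
of the recursion defining the constants. -/
theorem growth_comparison {b b' K Q s X : ℝ} {M : ℕ} (hb : 0 < b) (hK : 5 / 2 ≤ K)
    (hQ : 3 / 2 * K * b ^ 2 ≤ Q) (hs : s = 4 * (K * b + Q)) (hs2 : 2 < s)
    (hb' : b' ≤ b + Q / 3) (hMs : s ≤ M) (hM : (M : ℝ) ≤ s ^ 2 + 1) (hX : 0 < X)
    (hXb : X ≤ 1.9 * (M / s) * b') :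
    4 / 3 * Q * (Real.exp X - 1) ≤ X * ((1 + 2 * Q / s) ^ M - 1) := by
  have hs0 : 0 < s := by linarith
  have hKb : 5 / 2 * b ≤ K * b := mul_le_mul_of_nonneg_right hK hb.le
  have hQ0 : 0 < Q := lt_of_lt_of_le (by positivity) hQ
  set x := 2 * Q / s with hx
  set μ := (M : ℝ) / s with hμ
  have hx0 : 0 < x := by positivity
  have hμ1 : 1 ≤ μ := (one_le_div hs0).2 hMs
  have hx2 : x ≤ 1 / 2 := by rw [hx, div_le_iff₀ hs0, hs]; linarith [mul_pos (by linarith : 0 < K) hb]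
  have hMx : M * x = 2 * μ * Q := by rw [hx, hμ]; ring
  -- From log(1 + x) ≥ 2x/(x + 2). Since Mx = 2μQ, the bound x ≤ 1/2 gives the rate 1.6μQ and x ≤
  -- 2/9 gives 1.8μQ.
  have hpow : ∀ X₀ : ℝ, X₀ ≤ M * (2 * x / (x + 2)) → Real.exp X₀ ≤ (1 + x) ^ M := by
    intro X₀ hX₀
    have h1 := Real.le_log_one_add_of_nonneg hx0.le
    have h2 : (1 + x) ^ M = Real.exp (M * Real.log (1 + x)) := by
      rw [mul_comm, ← Real.rpow_def_of_pos (by linarith), Real.rpow_natCast]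
    rw [h2]
    exact Real.exp_le_exp.2 (hX₀.trans (mul_le_mul_of_nonneg_left h1 M.cast_nonneg))
  have hexpX : 0 ≤ Real.exp X - 1 := by linarith [Real.add_one_le_exp X]
  -- Either Q carries the growth by itself, or b is at least about Q/2; then Q ≥ 3/2 · K b² confines
  -- all the constants to a bounded range.
  rcases le_or_gt (1.9 * b') (1.6 * Q) with hcase | hcase
  · have hX1 : X ≤ 1.6 * μ * Q := by
      calc X ≤ μ * (1.9 * b') := by linarith
        _ ≤ μ * (1.6 * Q) := mul_le_mul_of_nonneg_left hcase (by linarith)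
        _ = _ := by ring
    have h1 := exp_secant hX hX1
    have h2 := hpow (1.6 * μ * Q) (by
      have : 0.8 * x ≤ 2 * x / (x + 2) := by
        rw [le_div_iff₀ (by linarith)]; nlinarith
      calc 1.6 * μ * Q = M * (0.8 * x) := by linarith
        _ ≤ _ := mul_le_mul_of_nonneg_left this M.cast_nonneg)
    have h3 : 4 / 3 * Q ≤ 1.6 * μ * Q := by nlinarith
    calc 4 / 3 * Q * (Real.exp X - 1) ≤ (Real.exp X - 1) * (1.6 * μ * Q) := by
          rw [mul_comm]; exact mul_le_mul_of_nonneg_left h3 hexpX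
      _ ≤ _ := h1
      _ ≤ ((1 + x) ^ M - 1) * X := mul_le_mul_of_nonneg_right (by linarith) hX.le
      _ = _ := by ring
  · have hbQ : 0.508 * Q ≤ b := by linarith
    have hx9 : x ≤ 2 / 9 := by rw [hx, div_le_iff₀ hs0, hs]; linarith
    -- The excess over 1.8Q is at most 1.9b − 4.375b², a concave quadratic with maximum below 0.21,
    -- attained near b = 0.2172.
    have hδ : 1.9 * b' ≤ 1.8 * Q + 0.21 := by
      have h1 : 3.75 * b ^ 2 ≤ Q := by
        have := mul_le_mul_of_nonneg_right hK (sq_nonneg b)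
        linarith
      have h2 := sq_nonneg (b - 0.2172)
      linarith
    have hc : K * b ≤ 1.32 := by
      by_contra! hc
      have h1 := mul_lt_mul_of_pos_right hc hb
      have h2 : K * b * b = K * b ^ 2 := by ring
      linarith
    have hμ10 : μ ≤ 10 := by
      have hs10 : s ≤ 9.5 := by rw [hs]; linarith
      rw [hμ, div_le_iff₀ hs0]
      have := mul_le_mul_of_nonneg_right hs10 hs0.le
      linarith
    have hX0 : 0 < 1.8 * μ * Q := by positivity
    have hXX : X ≤ 1.8 * μ * Q + 0.21 * μ := by
      calc X ≤ μ * (1.9 * b') := by linarith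
        _ ≤ μ * (1.8 * Q + 0.21) := mul_le_mul_of_nonneg_left hδ (by linarith)
        _ = _ := by ring
    have h1 := exp_secant hX hXX
    have h2 := exp_secant_shift hX0 (by linarith : 1.8 * μ * Q ≤ 1.8 * μ * Q + 0.21 * μ)
    rw [add_sub_cancel_left] at h2
    have h3 := hpow (1.8 * μ * Q) (by
      have : 0.9 * x ≤ 2 * x / (x + 2) := by
        rw [le_div_iff₀ (by linarith)]; nlinarith
      calc 1.8 * μ * Q = M * (0.9 * x) := by linarith
        _ ≤ _ := mul_le_mul_of_nonneg_left this M.cast_nonneg)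
    have h4 := exp_le_linear hμ1 hμ10
    set X₀ := 1.8 * μ * Q with hX₀
    set X₁ := X₀ + 0.21 * μ with hX₁
    have hX₁0 : 0 < X₁ := by linarith
    have hE0 : 0 ≤ Real.exp X₀ - 1 := by linarith [Real.add_one_le_exp X₀]
    have h5 : (Real.exp X - 1) * X₀ ≤ X * (Real.exp X₀ - 1) * (1.35 * μ) := by
      have : (Real.exp X - 1) * X₀ * X₁ ≤ X * (Real.exp X₀ - 1) * (1.35 * μ) * X₁ := by
        calc _ = (Real.exp X - 1) * X₁ * X₀ := by ring
          _ ≤ (Real.exp X₁ - 1) * X * X₀ := mul_le_mul_of_nonneg_right h1 hX0.le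
          _ = (Real.exp X₁ - 1) * X₀ * X := by ring
          _ ≤ X₁ * (Real.exp X₀ - 1) * Real.exp (0.21 * μ) * X :=
            mul_le_mul_of_nonneg_right h2 hX.le
          _ ≤ X₁ * (Real.exp X₀ - 1) * (1.35 * μ) * X := by gcongr
          _ = _ := by ring
      exact le_of_mul_le_mul_right this hX₁0
    have h6 : 4 / 3 * Q * (Real.exp X - 1) ≤ X * (Real.exp X₀ - 1) := by
      have : 4 / 3 * Q * (Real.exp X - 1) * (1.35 * μ) ≤ X * (Real.exp X₀ - 1) * (1.35 * μ) := by
        calc _ = (Real.exp X - 1) * X₀ := by rw [hX₀]; ring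
          _ ≤ _ := h5
      exact le_of_mul_le_mul_right this (by linarith)
    exact h6.trans (mul_le_mul_of_nonneg_left (by linarith) hX.le)

/-! ### The sequence Υ, block counts and the explicit constants. -/

section seq

variable {α C F D S : ℝ}

/-- The default value 0 at k = 0 makes Υ₁ an instance of the general step. -/
theorem seqUpsilon_succ (k : ℕ) :
    seqUpsilon d h α C F D S (k + 1) = seqUpsilon d h α C F D S k +
      2 * (4 * constZeta d h α C F D S)⁻¹ * (constG2star d h α C F D +
        constUpsilon d h α C F D S * seqUpsilon d h α C F D S k) := by
  rcases k with _ | k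
  · simp only [seqUpsilon]; ring
  · simp only [seqUpsilon]; ring

/-- Linear growth suffices when one block covers [0, 1], geometric growth is needed otherwise.
Lowering υ to Q only weakens the recursion. -/
theorem le_seqUpsilon (hζ : 0 ≤ constZeta d h α C F D S) (hG : 0 ≤ constG2star d h α C F D)
    {Q : ℝ} (hQ0 : 0 ≤ Q) (hQ : Q ≤ constUpsilon d h α C F D S) (k : ℕ) :
    k * (2 / (4 * constZeta d h α C F D S) * constG2star d h α C F D) ≤
      seqUpsilon d h α C F D S k ∧
    constG2star d h α C F D * ((1 + 2 * Q / (4 * constZeta d h α C F D S)) ^ k - 1) ≤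
      Q * seqUpsilon d h α C F D S k := by
  set s := 4 * constZeta d h α C F D S with hs
  have hs0 : 0 ≤ s := by positivity
  set G := constG2star d h α C F D
  set v := constUpsilon d h α C F D S
  have hv : 0 ≤ v := hQ0.trans hQ
  induction k with
  | zero => simp [seqUpsilon]
  | succ k ih =>
    obtain ⟨h1, h2⟩ := ih
    rw [seqUpsilon_succ]
    set u := seqUpsilon d h α C F D S k
    have hu : 0 ≤ u := le_trans (by positivity) h1
    have hi : 0 ≤ s⁻¹ := inv_nonneg.2 hs0
    have hvu : Q * u ≤ v * u := mul_le_mul_of_nonneg_right hQ hu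
    constructor
    · have h3 : 0 ≤ 2 * s⁻¹ * (v * u) := by positivity
      have e : ((k + 1 : ℕ) : ℝ) * (2 / s * G) = k * (2 / s * G) + 2 * s⁻¹ * G := by
        push_cast; ring
      rw [e, mul_add]
      linarith
    · have h3 : 2 * s⁻¹ * (Q * u) ≤ 2 * s⁻¹ * (v * u) := by gcongr
      have h4 := mul_le_mul_of_nonneg_left h3 hQ0
      have h5 := mul_le_mul_of_nonneg_right h2 (by positivity : 0 ≤ 1 + 2 * Q / s)
      have e1 : G * ((1 + 2 * Q / s) ^ (k + 1) - 1) =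
          G * ((1 + 2 * Q / s) ^ k - 1) * (1 + 2 * Q / s) + G * (2 * Q / s) := by ring
      have e2 : Q * (u + 2 * s⁻¹ * (G + v * u)) =
          Q * u + G * (2 * Q / s) + Q * (2 * s⁻¹ * (v * u)) := by ring
      have e3 : Q * u * (1 + 2 * Q / s) = Q * u + Q * (2 * s⁻¹ * (Q * u)) := by ring
      rw [e1, e2]
      linarith

end seq

/-- The total growth over R blocks of length 1/R is proportional to R^{1−α}. Doubling M costs at
most √2 < 1.42, since 1 − α < 1/2. -/
theorem mul_rpow_le_of_lt_two_mul {α s M R : ℝ} (hα : 1 / 2 < α) (hα' : α ≤ 1) (hs : 0 < s)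
    (hR : 0 < R) (hM : 0 < M) (hsM : s ≤ M ^ α) (hRM : R ≤ 2 * M) :
    R * (1 / R) ^ α ≤ 1.42 * (M / s) := by
  have h1 : R * (1 / R) ^ α = R ^ (1 - α) := by
    rw [one_div, Real.inv_rpow hR.le, Real.rpow_sub hR, Real.rpow_one]; rfl
  have h2 : (2 : ℝ) ^ (1 - α) ≤ 1.42 := by
    calc (2 : ℝ) ^ (1 - α) ≤ 2 ^ (1 / 2 : ℝ) :=
          Real.rpow_le_rpow_of_exponent_le one_le_two (by linarith)
      _ = √2 := (Real.sqrt_eq_rpow 2).symm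
      _ ≤ 1.42 := Real.sqrt_le_iff.2 ⟨by norm_num, by norm_num⟩
  have h3 : M ^ (1 - α) ≤ M / s := by
    rw [Real.rpow_sub hM, Real.rpow_one]
    exact div_le_div_of_nonneg_left hM.le hs hsM
  calc R * (1 / R) ^ α = R ^ (1 - α) := h1
    _ ≤ (2 * M) ^ (1 - α) := Real.rpow_le_rpow hR.le hRM (by linarith)
    _ = 2 ^ (1 - α) * M ^ (1 - α) := Real.mul_rpow zero_le_two hM.le
    _ ≤ 1.42 * (M / s) := by gcongr

theorem ceil_rpow_bounds {α s : ℝ} (hα : 1 / 2 < α) (hα' : α ≤ 1) (hs : 0 < s) :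
    s ≤ (⌈s ^ (1 / α)⌉₊ : ℝ) ^ α ∧ 1 ≤ (⌈s ^ (1 / α)⌉₊ : ℝ) ∧ s ≤ (⌈s ^ (1 / α)⌉₊ : ℝ) ∧
      (1 ≤ s → (⌈s ^ (1 / α)⌉₊ : ℝ) ≤ s ^ 2 + 1) := by
  have hα0 : 0 < α := by linarith
  have hp : 0 < s ^ (1 / α) := Real.rpow_pos_of_pos hs _
  have hle := Nat.le_ceil (s ^ (1 / α))
  have h1 : (1 : ℝ) ≤ ⌈s ^ (1 / α)⌉₊ := by exact_mod_cast Nat.ceil_pos.2 hp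
  refine ⟨?_, h1, ?_, fun hs1 => ?_⟩
  · calc s = (s ^ (1 / α)) ^ α := by
          rw [← Real.rpow_mul hs.le, one_div_mul_cancel hα0.ne', Real.rpow_one]
      _ ≤ _ := Real.rpow_le_rpow hp.le hle hα0.le
  · rcases le_total s 1 with hs1 | hs1
    · exact hs1.trans h1
    · refine le_trans ?_ hle
      calc s = s ^ (1 : ℝ) := (Real.rpow_one s).symm
        _ ≤ _ := Real.rpow_le_rpow_of_exponent_le hs1 ((one_le_div hα0).2 hα')
  · have h2 := (Nat.ceil_lt_add_one hp.le).le
    have h3 : s ^ (1 / α) ≤ s ^ 2 := by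
      rw [← Real.rpow_natCast]
      refine Real.rpow_le_rpow_of_exponent_le hs1 ?_
      rw [div_le_iff₀ hα0]
      push_cast
      linarith
    linarith

/-- A dyadic number of blocks makes the block ends grid points, at the price of a factor 2. -/
theorem exists_two_pow_between {M : ℕ} (hM : 0 < M) : ∃ m : ℕ, M ≤ 2 ^ m ∧ 2 ^ m ≤ 2 * M := by
  refine ⟨Nat.clog 2 M, Nat.le_pow_clog one_lt_two M, ?_⟩
  rcases Nat.lt_or_ge 1 M with h1 | h1
  · have h2 := Nat.pow_pred_clog_lt_self one_lt_two h1
    have h3 := Nat.clog_pos one_lt_two h1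
    obtain ⟨c, hc⟩ := Nat.exists_eq_succ_of_ne_zero h3.ne'
    rw [hc] at h2 ⊢
    simp only [Nat.pred_succ, Nat.succ_eq_add_one, pow_succ] at h2 ⊢
    omega
  · obtain rfl : M = 1 := by omega
    simp

section constants

variable {α C F D S : ℝ}

theorem constG1star_ge (hα' : α ≤ 1) (hC : 0 < C) (hF : 0 ≤ F)
    (hpos : 0 < 2 * d * h * C * constK (2 * α) * D) :
    2 * (h * F * C) ≤ constG1star d h α C F D := by
  have hp := Real.rpow_pos_of_pos hpos (1 / α)
  have h1 : (1 : ℝ) ≤ ⌈(2 * d * h * C * constK (2 * α) * D) ^ (1 / α)⌉₊ := by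
    exact_mod_cast Nat.ceil_pos.2 hp
  have h2 := Real.one_le_rpow h1 (by linarith : 0 ≤ 1 - α)
  unfold constG1star
  have h3 : 0 ≤ 2 * (h * F * C) := by positivity
  have := mul_le_mul_of_nonneg_left h2 h3
  linarith

/-- All that is needed of G₁: with G₁* ≥ 2hFC it provides the factor 3/2 in the lower bounds for Q.
-/
theorem constG1_ge (hα : 1 / 2 < α) (hC : 0 < C) (hF : 0 ≤ F) (hD : 0 ≤ D) :
    h * F * C ≤ constG1 h α C F D := by
  have h1 : (2 : ℝ) ^ (1 - 2 * α) < 1 :=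
    Real.rpow_lt_one_of_one_lt_of_neg one_lt_two (by linarith)
  have hL : 0 ≤ constL h α C F D := by
    unfold constL
    have : 0 < 1 - (2 : ℝ) ^ (1 - 2 * α) := by linarith
    positivity
  have hω : 0 ≤ constOmega h α C F D := by
    unfold constOmega
    positivity
  have hω' := inv_nonneg.2 hω
  unfold constG1
  have h2 : 0 ≤ (h : ℝ) * F * C := by positivity
  nlinarith [mul_nonneg hL hω', mul_nonneg h2 hω']

end constants

/-! ### Assembling the error bound. -/

/-- Summing up the errors of blocks of dyadic length, chosen according to the size of the
constants. -/
theorem error_le_of_blocks {α b q K Q s g V : ℝ} {n M : ℕ} (hα : 1 / 2 < α) (hα' : α ≤ 1)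
    (hb0 : 0 < b) (hq0 : 0 ≤ q) (hK : 5 / 2 ≤ K) (hQ2 : 3 / 2 * K * b ^ 2 ≤ Q)
    (hqQ : 3 / 2 * K * q ≤ Q) (hsKQ : s = 4 * (K * b + Q)) (hM1 : s ≤ (M : ℝ) ^ α)
    (hM2 : 1 ≤ (M : ℝ)) (hM3 : s ≤ M) (hM4 : 1 ≤ s → (M : ℝ) ≤ s ^ 2 + 1) (hg0 : 0 ≤ g)
    {e : ℕ → ℝ} (hnn : ∀ k, 0 ≤ e k) (he0 : e 0 = 0)
    (hblock : ∀ (o L : ℕ) (w r b' : ℝ), o + L ≤ 2 ^ n → (L * (1 / 2 ^ n : ℝ)) ^ α = w →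
      b' = b + (K - 1) * w * q → r = w * (K * b + (K - 1) * w * q) → r ≤ 1 / 2 →
      ∀ j ≤ L, e (o + j) ≤ e o + 1 / (1 - r) * (g * (L * (1 / 2 ^ n)) + w * b' * e o))
    (hstep1 : ∀ k < 2 ^ n, e (k + 1) ≤ (1 + b * (1 / 2 ^ n : ℝ) ^ α) * e k + g * (1 / 2 ^ n))
    {k : ℕ} (hk : k ≤ 2 ^ n) (hV1 : 2 * g * (M / s) ≤ V)
    (hV2 : g * ((1 + 2 * Q / s) ^ M - 1) ≤ Q * V) : e k ≤ V := by
  have hα0 : 0 < α := by linarith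
  have hKb0 : 0 < K * b := mul_pos (by linarith) hb0
  have hQ0 : 0 < Q := lt_of_lt_of_le (mul_pos (by linarith) (pow_pos hb0 2)) hQ2
  have hs0 : 0 < s := by rw [hsKQ]; positivity
  have h2n : (0 : ℝ) < 2 ^ n := by positivity
  have hκq : (K - 1) * q ≤ 2 / 3 * Q := by linarith
  set Δ := (1 : ℝ) / 2 ^ n with hΔ
  have hΔ0 : 0 < Δ := by positivity
  -- For s ≤ 2 the contraction factor over all of [0, 1] is at most s/4 ≤ 1/2, and no iteration is
  -- needed.
  rcases le_or_gt s 2 with hs2 | hs2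
  · -- a single block
    have hL : ((2 ^ n : ℕ) : ℝ) * Δ = 1 := by rw [hΔ]; push_cast; field_simp
    have h1 := hblock 0 (2 ^ n) 1 (K * b + (K - 1) * q) (b + (K - 1) * q) (by omega)
      (by rw [hL, Real.one_rpow]) (by ring) (by ring) (by linarith) k hk
    rw [zero_add, he0, hL, mul_zero, add_zero, mul_one, zero_add] at h1
    have h2 : 1 / (1 - (K * b + (K - 1) * q)) ≤ 2 := by
      rw [div_le_iff₀ (by linarith)]; linarith
    refine h1.trans (le_trans ?_ hV1)
    have h4 : 1 ≤ M / s := (one_le_div hs0).2 hM3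
    calc _ ≤ 2 * g := mul_le_mul_of_nonneg_right h2 hg0
      _ ≤ _ := le_mul_of_one_le_right (by linarith) h4
  · have hM0 : 0 < M := by exact_mod_cast zero_lt_one.trans_le hM2
    obtain ⟨m, hm1, hm2⟩ := exists_two_pow_between hM0
    have hm1' : (M : ℝ) ≤ 2 ^ m := by exact_mod_cast hm1
    have hm2' : (2 : ℝ) ^ m ≤ 2 * M := by exact_mod_cast hm2
    have h2m : (0 : ℝ) < 2 ^ m := by positivity
    -- Since 2^m ≥ M and M^α ≥ s, this gives ws ≤ 1, hence r ≤ 1/4, and w ≤ 1/2, hence b' ≤ b + Q/3.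
    set w := (1 / (2 : ℝ) ^ m) ^ α with hw
    have hw0 : 0 < w := by positivity
    have hws : w * s ≤ 1 := by
      rw [hw, one_div, Real.inv_rpow h2m.le, inv_mul_le_iff₀ (by positivity), mul_one]
      exact hM1.trans (Real.rpow_le_rpow (by linarith) hm1' hα0.le)
    have hw2 : w ≤ 1 / 2 := by nlinarith
    set b' := b + (K - 1) * w * q with hb'
    have hκwq : (K - 1) * w * q ≤ Q / 3 := by
      have h1 : (K - 1) * w * q = w * ((K - 1) * q) := by ring
      rw [h1]
      nlinarith
    have hκwq0 : 0 ≤ (K - 1) * w * q := by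
      have : 0 ≤ K - 1 := by linarith
      positivity
    have hb'0 : 0 < b' := by linarith
    set r := w * (K * b + (K - 1) * w * q) with hr
    have hr4 : r ≤ 1 / 4 := by
      have h1 : K * b + (K - 1) * w * q ≤ s / 4 := by linarith
      have h2 := mul_le_mul_of_nonneg_left h1 hw0.le
      linarith
    have hfin : ∀ X : ℝ, 0 < X → X ≤ 1.9 * (M / s) * b' →
        X * e k ≤ 4 / 3 * g * (Real.exp X - 1) → e k ≤ V := by
      intro X hX0 hX1 hX2
      have h1 := growth_comparison hb0 hK hQ2 hsKQ hs2 (by linarith : b' ≤ b + Q / 3) hM3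
        (hM4 (by linarith)) hX0 hX1
      have h2 : X * (Q * e k) ≤ X * (g * ((1 + 2 * Q / s) ^ M - 1)) := by
        calc X * (Q * e k) = Q * (X * e k) := by ring
          _ ≤ Q * (4 / 3 * g * (Real.exp X - 1)) := mul_le_mul_of_nonneg_left hX2 hQ0.le
          _ = g * (4 / 3 * Q * (Real.exp X - 1)) := by ring
          _ ≤ g * (X * ((1 + 2 * Q / s) ^ M - 1)) := mul_le_mul_of_nonneg_left h1 hg0
          _ = _ := by ring
      have h3 := le_of_mul_le_mul_left h2 hX0
      exact le_of_mul_le_mul_left (h3.trans hV2) hQ0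
    -- Multiplying by R brings both Gronwall bounds into the form required by `hfin`, with X = RΓ
    -- the total growth.
    have hexp : ∀ (Γ B : ℝ) (R : ℕ), 0 < Γ → 0 < R → 0 ≤ B →
        Γ * e k ≤ B * ((1 + Γ) ^ R - 1) → R * Γ * e k ≤ R * B * (Real.exp (R * Γ) - 1) := by
      intro Γ B R hΓ hR hB hle
      have h1 : (1 + Γ) ^ R ≤ Real.exp (R * Γ) := by
        rw [Real.exp_nat_mul]
        exact pow_le_pow_left₀ (by linarith) (by linarith [Real.add_one_le_exp Γ]) R
      have h2 : B * ((1 + Γ) ^ R - 1) ≤ B * (Real.exp (R * Γ) - 1) := by gcongr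
      have h3 := mul_le_mul_of_nonneg_left (hle.trans h2) (Nat.cast_nonneg (α := ℝ) R)
      linarith
    have hMs0 : 0 < (M : ℝ) / s := by positivity
    rcases le_or_gt m n with hmn | hmn
    · -- blocks of several grid cells
      have hamp : 1 / (1 - r) ≤ 4 / 3 := by
        rw [div_le_iff₀ (by linarith)]; linarith
      have hamp0 : 0 < 1 / (1 - r) := by
        have : 0 < 1 - r := by linarith
        positivity
      set A := 1 / (1 - r) with hA
      have hRL : 2 ^ m * 2 ^ (n - m) = 2 ^ n := by rw [← pow_add]; congr 1; omega
      have hLΔ : ((2 ^ (n - m) : ℕ) : ℝ) * Δ = 1 / 2 ^ m := by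
        have h1 : (2 : ℝ) ^ m * 2 ^ (n - m) = 2 ^ n := by exact_mod_cast hRL
        rw [hΔ, ← h1]; push_cast; field_simp
      have h1 := gronwall_blocks (e := e) (B := A * (g * (1 / 2 ^ m))) (Γ := A * (w * b'))
        (by positivity) (by positivity) (R := 2 ^ m) (L := 2 ^ (n - m)) (by positivity) he0
        (fun j hj i hi => by
          have := hblock (j * 2 ^ (n - m)) (2 ^ (n - m)) w r b' (by
            have : (j + 1) * 2 ^ (n - m) ≤ 2 ^ m * 2 ^ (n - m) := Nat.mul_le_mul_right _ hj
            rw [hRL] at this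
            linarith) (by rw [hLΔ]) rfl rfl (by linarith) i hi
          rw [hLΔ] at this
          linarith) (k := k) (by rw [hRL]; exact hk)
      have h2 := hexp _ _ _ (by positivity) (by positivity) (by positivity) h1
      push_cast at h2
      refine hfin _ (by positivity) ?_ (h2.trans ?_)
      · have h3 := mul_rpow_le_of_lt_two_mul hα hα' hs0 h2m (by linarith) hM1 hm2'
        -- Amplification 4/3 times block-count factor 1.42 stays below 1.9.
        calc (2 : ℝ) ^ m * (A * (w * b')) = A * (2 ^ m * w) * b' := by ring
          _ ≤ 4 / 3 * (1.42 * (M / s)) * b' := by gcongr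
          _ ≤ 1.9 * (M / s) * b' := by
            refine mul_le_mul_of_nonneg_right ?_ hb'0.le
            linarith
      · have h3 : (2 : ℝ) ^ m * (A * (g * (1 / 2 ^ m))) = A * g := by field_simp
        rw [h3]
        refine mul_le_mul_of_nonneg_right (mul_le_mul_of_nonneg_right hamp hg0) ?_
        have h4 : 0 ≤ (2 : ℝ) ^ m * (A * (w * b')) := by positivity
        linarith [Real.add_one_le_exp ((2 : ℝ) ^ m * (A * (w * b')))]
    · -- the grid is coarser than the blocks
      have h1 := gronwall_blocks (e := e) (B := g * Δ) (Γ := b * Δ ^ α)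
        (by positivity) (by positivity) (R := 2 ^ n) (L := 1) one_pos he0
        (fun j hj i hi => by
          rw [mul_one]
          have he0' : 0 ≤ e j := hnn j
          rcases Nat.le_one_iff_eq_zero_or_eq_one.1 hi with rfl | rfl
          · have : 0 ≤ b * Δ ^ α * e j := by positivity
            have : 0 ≤ g * Δ := by positivity
            rw [add_zero]
            linarith
          · exact hstep1 j hj) (k := k) (by simpa using hk)
      have h2 := hexp _ _ _ (by positivity) (by positivity) (by positivity) h1
      push_cast at h2
      have h2nm : (2 : ℝ) ^ n ≤ 2 ^ m := pow_le_pow_right₀ one_le_two hmn.le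
      refine hfin _ (by positivity) ?_ (h2.trans ?_)
      · have h3 := mul_rpow_le_of_lt_two_mul hα hα' hs0 h2n (by linarith) hM1 (h2nm.trans hm2')
        have h4 : b ≤ b' := by linarith
        calc (2 : ℝ) ^ n * (b * Δ ^ α) = (2 ^ n * Δ ^ α) * b := by ring
          _ ≤ 1.42 * (M / s) * b' := by gcongr
          _ ≤ 1.9 * (M / s) * b' := by
            refine mul_le_mul_of_nonneg_right ?_ hb'0.le
            linarith
      · have h3 : (2 : ℝ) ^ n * (g * Δ) = g := by rw [hΔ]; field_simp
        rw [h3]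
        have h4 : 0 ≤ (2 : ℝ) ^ n * (b * Δ ^ α) := by positivity
        refine mul_le_mul_of_nonneg_right (by linarith) ?_
        linarith [Real.add_one_le_exp ((2 : ℝ) ^ n * (b * Δ ^ α))]

/-- The error of the Euler scheme at the grid points. -/
theorem grid_error {α C : ℝ} (hα : 1 / 2 < α) (hα' : α ≤ 1) (hC : 0 < C)
    {f : (Fin d → ℝ) → Matrix (Fin d) (Fin h) ℝ} (hf : IsC2Bounded f)
    (hf' : ∃ z w, f z ≠ f w) {x : ℝ → Fin h → ℝ}
    (hx : ∀ s ∈ Set.Icc (0 : ℝ) 1, ∀ t ∈ Set.Icc (0 : ℝ) 1, ‖x t - x s‖ ≤ C * |t - s| ^ α)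
    {y₀ : Fin d → ℝ} {y : ℝ → Fin d → ℝ} (hy : IsYoungSolution f x y₀ y)
    (hyH : ∀ s t, 0 ≤ s → s ≤ t → t ≤ 1 →
      ‖y t - y s‖ ≤ constG1star d h α C (supAbs f) (supGrad f) * (t - s) ^ α)
    (n : ℕ) {k : ℕ} (hk : k ≤ 2 ^ n) :
    ‖y ((k : ℝ) / 2 ^ n) - eulerGrid f x y₀ n k‖ ≤
      seqUpsilon d h α C (supAbs f) (supGrad f) (supHess f)
        ⌈(4 * constZeta d h α C (supAbs f) (supGrad f) (supHess f)) ^ (1 / α)⌉₊ *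
      ((1 : ℝ) / 2 ^ n) ^ (2 * α - 1) := by
  obtain ⟨hd, hh, hF, hD⟩ := pos_of_nonconst hf hf'
  have hLip := abs_sub_le_supGrad hf
  have hsq := sq_supGrad_le hf
  have hS : 0 ≤ supHess f := supHess_nonneg
  have hFle := le_supAbs hf
  have hsec : ∀ (y z y' z' : Fin d → ℝ) (ξ : ℝ), ‖y - y'‖ ≤ ξ → ‖z - z'‖ ≤ ξ → ∀ i j,
      |(f y i j - f z i j) - (f y' i j - f z' i j)| ≤
        d * supGrad f * ‖(y - z) - (y' - z')‖ + d ^ 2 * supHess f * ξ * ‖y - z‖ :=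
    fun y z y' z' ξ h1 h2 i j => abs_sub_sub_sub_le (hf.contDiff i j) hD.le hS
      (fun k z => le_supGrad hf i j k z) (fun k l z => le_supHess hf i j k l z) y z y' z' h1 h2
  set F := supAbs f with hFd
  set D := supGrad f with hDd
  set S := supHess f with hSd
  have hd0 : (0 : ℝ) < d := by exact_mod_cast hd
  have hh0 : (0 : ℝ) < h := by exact_mod_cast hh
  have hα0 : 0 < α := by linarith
  have hK := constK_ge (by linarith : 1 < 2 * α) (by linarith)
  have hG1s := constG1star_ge (d := d) (h := h) hα' hC hF.le
    (by positivity : 0 < 2 * d * h * C * constK (2 * α) * D)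
  have hG1 := constG1_ge (h := h) hα hC hF.le hD.le
  set K := constK (2 * α) with hKd
  set Λ := (d : ℝ) * D with hΛ
  set Θ := (d : ℝ) ^ 2 * S with hΘ
  set η := 2 * (h * F * C) with hη
  set b := h * Λ * C with hb
  set q := h * Θ * η * C with hq
  set G1s := constG1star d h α C F D with hG1sd
  set G1 := constG1 h α C F D with hG1d
  set Q := C * (d ^ 2 * h * K * S * (G1s + G1)) with hQ
  set s := 4 * constZeta d h α C F D S with hs
  set M := ⌈s ^ (1 / α)⌉₊ with hM
  set G2 := constG2star d h α C F D with hG2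
  set Δ := (1 : ℝ) / 2 ^ n with hΔ
  set Z := eulerGrid f x y₀ n with hZ
  have hb0 : 0 < b := by positivity
  have hΘ0 : 0 ≤ Θ := by positivity
  have hη0 : 0 < η := by positivity
  have hq0 : 0 ≤ q := by positivity
  have hG1s0 : 0 ≤ G1s := hη0.le.trans hG1s
  -- Landau's inequality, multiplied by (hdC)².
  have hbq : b ^ 2 ≤ q := by
    have := mul_le_mul_of_nonneg_left hsq (by positivity : 0 ≤ ((h : ℝ) * d * C) ^ 2)
    rw [hb, hq, hη, hΛ, hΘ]
    linarith
  have hqQ : 3 / 2 * K * q ≤ Q := by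
    have h1 : η * (3 / 2) ≤ G1s + G1 := by rw [hη] at hG1s ⊢; linarith
    have := mul_le_mul_of_nonneg_left h1 (by positivity : 0 ≤ C * (d ^ 2 * h * K * S))
    rw [hq, hQ, hΘ]
    linarith
  have hsKQ : s = 4 * (K * b + Q) := by rw [hs, hb, hQ, hΛ]; unfold constZeta; ring
  have hKb0 : 0 < K * b := by positivity
  have hQ2 : 3 / 2 * K * b ^ 2 ≤ Q :=
    (mul_le_mul_of_nonneg_left hbq (by positivity)).trans hqQ
  have hQ0 : 0 < Q := lt_of_lt_of_le (by positivity) hQ2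
  have hs0 : 0 < s := by rw [hsKQ]; positivity
  have hυ : Q ≤ constUpsilon d h α C F D S := by
    have : constUpsilon d h α C F D S = Q + C * (d * D) := by rw [hQ]; unfold constUpsilon; ring
    rw [this]
    have : 0 < C * (d * D) := by positivity
    linarith
  have hG2b : G2 = K * b * G1s := by rw [hG2, hb, hΛ]; unfold constG2star; ring
  have hG20 : 0 ≤ G2 := by rw [hG2b]; positivity
  obtain ⟨hU1, hU2⟩ := le_seqUpsilon (d := d) (h := h) (α := α) (C := C) (F := F) (D := D) (S := S)
    (by linarith) hG20 hQ0.le hυ M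
  rw [← hs, ← hG2] at hU1 hU2
  set U := seqUpsilon d h α C F D S M with hU
  obtain ⟨hM1, hM2, hM3, hM4⟩ := ceil_rpow_bounds hα hα' hs0
  rw [← hM] at hM1 hM2 hM3 hM4
  have h2n : (0 : ℝ) < 2 ^ n := by positivity
  have hΔ0 : 0 < Δ := by positivity
  have hΔx0 : 0 < Δ ^ (2 * α - 1) := Real.rpow_pos_of_pos hΔ0 _
  set g := G2 * Δ ^ (2 * α - 1) with hg
  have hg0 : 0 ≤ g := by positivity
  have hκq : (K - 1) * q ≤ 2 / 3 * Q := by linarith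
  -- data on the grid
  have hgrid : ∀ k : ℕ, (k : ℝ) / 2 ^ n = k * Δ := fun k => by rw [hΔ]; ring
  have hgrid01 : ∀ k : ℕ, k ≤ 2 ^ n → 0 ≤ (k : ℝ) * Δ ∧ (k : ℝ) * Δ ≤ 1 := fun k hk => by
    rw [← hgrid, div_le_one h2n]
    exact ⟨by positivity, by exact_mod_cast hk⟩
  have hX : ∀ o i j : ℕ, i ≤ j → o + j ≤ 2 ^ n →
      ‖x ((o + j : ℕ) * Δ) - x ((o + i : ℕ) * Δ)‖ ≤ C * (j * Δ - i * Δ) ^ α := by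
    intro o i j hij hj
    have h1 := hx _ (hgrid01 (o + i) (by omega)) _ (hgrid01 (o + j) hj)
    have h2 : ((o + j : ℕ) : ℝ) * Δ - (o + i : ℕ) * Δ = j * Δ - i * Δ := by push_cast; ring
    have h3 := (mul_sub_mul_mem hΔ0.le hij le_rfl).1
    rwa [h2, abs_of_nonneg h3] at h1
  have hZs : ∀ k, Z (k + 1) = Z k + (f (Z k)).mulVec (x ((k + 1 : ℕ) * Δ) - x (k * Δ)) := by
    intro k
    rw [← hgrid, ← hgrid]
    rfl
  have hYs : ∀ k < 2 ^ n, ‖y ((k + 1 : ℕ) * Δ) - y (k * Δ) -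
      (f (y (k * Δ))).mulVec (x ((k + 1 : ℕ) * Δ) - x (k * Δ))‖ ≤ g * Δ := by
    intro k hk
    have h1 := hgrid01 k hk.le
    have h2 := hgrid01 (k + 1) hk
    have h3 : ((k + 1 : ℕ) : ℝ) * Δ - k * Δ = Δ := by push_cast; ring
    have h4 := hy.norm_sub_sub_mulVec_le hα hC.le (by positivity : 0 ≤ Λ) hLip hx hG1s0 h1.1
      (by linarith) h2.2 (monotone_id.monotoneOn _)
      (fun a b ha hab hb => hyH a b (h1.1.trans ha) hab (hb.trans h2.2))
    simp only [id, h3] at h4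
    refine h4.trans ?_
    have h5 : Δ ^ α * Δ ^ α = Δ ^ (2 * α - 1) * Δ := by
      rw [← Real.rpow_add hΔ0, ← Real.rpow_add_one hΔ0.ne']
      congr 1; ring
    rw [h5, hg, hG2b, ← hKd, ← hb]
    have h6 : (K - 1) * b * G1s ≤ K * b * G1s := by gcongr; linarith
    have := mul_le_mul_of_nonneg_right h6 (by positivity : 0 ≤ Δ ^ (2 * α - 1) * Δ)
    linarith
  set e : ℕ → ℝ := fun k => ‖y (k * Δ) - Z k‖ with he
  have he0 : e 0 = 0 := by
    have : Z 0 = y₀ := rfl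
    simp [he, this, hy.apply_zero]
  rw [hgrid]
  change e k ≤ U * Δ ^ (2 * α - 1)
  -- one block
  have hblock : ∀ (o L : ℕ) (w r b' : ℝ), o + L ≤ 2 ^ n → (L * Δ) ^ α = w →
      b' = b + (K - 1) * w * q → r = w * (K * b + (K - 1) * w * q) → r ≤ 1 / 2 →
      ∀ j ≤ L, e (o + j) ≤ e o + 1 / (1 - r) * (g * (L * Δ) + w * b' * e o) := by
    intro o L w r b' hoL hw hb' hr hr2 j hj
    have hw0 : 0 ≤ w := by rw [← hw]; positivity
    -- The contraction condition on r already implies the smallness for the local Hölder bounds, so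
    -- on the block y and the scheme share the constant η = 2hFC.
    have hsmall : (K - 1) * b * w ≤ 1 / 2 := by
      have h1 : 0 ≤ w * ((K - 1) * w * q) := by
        have : 0 ≤ K - 1 := by linarith
        positivity
      have h2 : 0 ≤ w * b := by positivity
      linarith
    have hLΔ1 := (hgrid01 (o + L) hoL).2
    have hYη : ∀ i j : ℕ, i ≤ j → j ≤ L →
        ‖y ((o + j : ℕ) * Δ) - y ((o + i : ℕ) * Δ)‖ ≤ η * (j * Δ - i * Δ) ^ α := by
      intro i j hij hj
      have h2 : ((o + j : ℕ) : ℝ) * Δ - (o + i : ℕ) * Δ = j * Δ - i * Δ := by push_cast; ring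
      have h3 := mul_sub_mul_mem hΔ0.le hij hj
      have := hy.norm_sub_le_local hα hC.le hF.le hFle (by positivity : 0 ≤ Λ) hLip hx
        (by positivity : 0 ≤ L * Δ) (by rw [hw]; exact hsmall)
        (hgrid01 (o + i) (by omega)).1 (by linarith [h3.1])
        (hgrid01 (o + j) (by omega)).2 (by linarith [h3.2])
      rwa [h2] at this
    have hZη : ∀ i j : ℕ, i ≤ j → j ≤ L → ‖Z (o + j) - Z (o + i)‖ ≤ η * (j * Δ - i * Δ) ^ α :=
      fun i j hij hj => euler_norm_sub_le hα hC.le hΔ0 hF.le hFle (by positivity : 0 ≤ Λ) hLip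
        (X := fun i => x ((o + i : ℕ) * Δ)) (Z := fun i => Z (o + i))
        (fun i j hij hj => hX o i j hij (by omega)) (fun i _ => hZs (o + i))
        (by rw [hw]; exact hsmall) hij hj
    exact euler_error_block hα hα' hC.le hΔ0 hη0.le hg0 hΘ0 (by positivity : 0 ≤ Λ) hLip hsec
      (X := fun i => x ((o + i : ℕ) * Δ)) (Y := fun i => y ((o + i : ℕ) * Δ))
      (Z := fun i => Z (o + i)) (fun i j hij hj => hX o i j hij (by omega))
      (fun i _ => hZs (o + i)) (fun i hi => hYs (o + i) (by omega)) hYη hZη hw hb' hr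
      (by linarith) hj
  have hstep1 : ∀ k < 2 ^ n, e (k + 1) ≤ (1 + b * Δ ^ α) * e k + g * Δ := by
    intro k hk
    have h1 := hYs k hk
    have h2 := hX k 0 1 zero_le_one hk
    simp only [Nat.cast_zero, zero_mul, sub_zero, add_zero, Nat.cast_one, one_mul] at h2
    have h3 := norm_mulVec_le (by positivity : 0 ≤ Λ * e k)
      (A := f (y (k * Δ)) - f (Z k)) (fun i j => hLip _ _ i j) (x ((k + 1 : ℕ) * Δ) - x (k * Δ))
    have h4 : y ((k + 1 : ℕ) * Δ) - Z (k + 1) = (y (k * Δ) - Z k) +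
        (f (y (k * Δ)) - f (Z k)).mulVec (x ((k + 1 : ℕ) * Δ) - x (k * Δ)) +
        (y ((k + 1 : ℕ) * Δ) - y (k * Δ) -
          (f (y (k * Δ))).mulVec (x ((k + 1 : ℕ) * Δ) - x (k * Δ))) := by
      rw [hZs, Matrix.sub_mulVec]; abel
    have h5 : e (k + 1) ≤ _ := (congrArg norm h4).le.trans (norm_add₃_le)
    have h6 : h * (Λ * e k) * ‖x ((k + 1 : ℕ) * Δ) - x (k * Δ)‖ ≤
        h * (Λ * e k) * (C * Δ ^ α) := by
      have : 0 ≤ e k := norm_nonneg _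
      gcongr
    have h7 : h * (Λ * e k) * (C * Δ ^ α) = b * Δ ^ α * e k := by rw [hb]; ring
    have h8 : ‖y (k * Δ) - Z k‖ = e k := rfl
    linarith
  refine error_le_of_blocks (e := e) hα hα' hb0 hq0 hK hQ2 hqQ hsKQ hM1 hM2 hM3 hM4 hg0
    (fun k => norm_nonneg _) he0 hblock hstep1 hk ?_ ?_
  · calc 2 * g * (M / s) = M * (2 / s * G2) * Δ ^ (2 * α - 1) := by rw [hg]; ring
      _ ≤ _ := mul_le_mul_of_nonneg_right hU1 hΔx0.le
  · calc g * ((1 + 2 * Q / s) ^ M - 1) =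
        G2 * ((1 + 2 * Q / s) ^ M - 1) * Δ ^ (2 * α - 1) := by rw [hg]; ring
      _ ≤ Q * U * Δ ^ (2 * α - 1) := mul_le_mul_of_nonneg_right hU2 hΔx0.le
      _ = _ := by ring

/-- The global Hölder constant of a solution. -/
theorem IsYoungSolution.norm_sub_le_constG1star {α C : ℝ} (hα : 1 / 2 < α) (hα' : α ≤ 1)
    (hC : 0 < C) {f : (Fin d → ℝ) → Matrix (Fin d) (Fin h) ℝ} (hf : IsC2Bounded f)
    (hf' : ∃ z w, f z ≠ f w) {x : ℝ → Fin h → ℝ}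
    (hx : ∀ s ∈ Set.Icc (0 : ℝ) 1, ∀ t ∈ Set.Icc (0 : ℝ) 1, ‖x t - x s‖ ≤ C * |t - s| ^ α)
    {y₀ : Fin d → ℝ} {y : ℝ → Fin d → ℝ} (hy : IsYoungSolution f x y₀ y) {s t : ℝ} (hs : 0 ≤ s)
    (hst : s ≤ t) (ht : t ≤ 1) :
    ‖y t - y s‖ ≤ constG1star d h α C (supAbs f) (supGrad f) * (t - s) ^ α := by
  obtain ⟨hd, hh, hF, hD⟩ := pos_of_nonconst hf hf'
  have hd0 : (0 : ℝ) < d := by exact_mod_cast hd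
  have hh0 : (0 : ℝ) < h := by exact_mod_cast hh
  have hK := constK_ge (by linarith : 1 < 2 * α) (by linarith)
  have hpos : 0 < 2 * d * h * C * constK (2 * α) * supGrad f := by positivity
  obtain ⟨hN1, hN2, -, -⟩ := ceil_rpow_bounds hα hα' hpos
  set N := ⌈(2 * d * h * C * constK (2 * α) * supGrad f) ^ (1 / α)⌉₊ with hN
  have hN0 : 0 < N := by exact_mod_cast zero_lt_one.trans_le hN2
  have hNr : (0 : ℝ) < N := by linarith
  -- The ceiling in G₁* is chosen so that N^α ≥ 2dhCK(2α)|∇f|, the absorption condition on the scale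
  -- 1/N.
  have hl : (constK (2 * α) - 1) * (h * (d * supGrad f) * C) * (1 / (N : ℝ)) ^ α ≤ 1 / 2 := by
    have hNα : 0 < (N : ℝ) ^ α := by positivity
    rw [one_div (N : ℝ), Real.inv_rpow hNr.le, ← div_eq_mul_inv, div_le_iff₀ hNα]
    have : 0 < h * (d * supGrad f) * C := by positivity
    linarith
  have h1 := norm_sub_le_of_local hN0 (fun s t hs hst ht hst' =>
    hy.norm_sub_le_local hα hC.le hF.le (le_supAbs hf) (by positivity : 0 ≤ d * supGrad f)
      (abs_sub_le_supGrad hf) hx (by positivity : 0 ≤ 1 / (N : ℝ)) hl hs hst ht hst') hs hst ht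
  refine h1.trans (le_of_eq ?_)
  unfold constG1star
  rw [← hN]
  ring

end YoungEuler

theorem theorem6 {d h : ℕ} (α C : ℝ) (hα : 1 / 2 < α) (hα' : α ≤ 1) (hC : 0 < C)
    (f : (Fin d → ℝ) → Matrix (Fin d) (Fin h) ℝ) (hf : YoungEuler.IsC2Bounded f)
    (hf' : ∃ z w, f z ≠ f w)
    (x : ℝ → Fin h → ℝ)
    (hx : ∀ s ∈ Set.Icc (0 : ℝ) 1, ∀ t ∈ Set.Icc (0 : ℝ) 1, ‖x t - x s‖ ≤ C * |t - s| ^ α)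
    (y₀ : Fin d → ℝ) (y : ℝ → Fin d → ℝ) (hy : YoungEuler.IsYoungSolution f x y₀ y)
    (n : ℕ) :
    ∀ t ∈ Set.Icc (0 : ℝ) 1,
      ‖YoungEuler.eulerPath f x y₀ n t - y t‖ ≤
        YoungEuler.constG d h α C (YoungEuler.supAbs f) (YoungEuler.supGrad f)
          (YoungEuler.supHess f) * ((1 : ℝ) / 2 ^ n) ^ (2 * α - 1) := by
  intro t ht
  have hyH : ∀ s t, 0 ≤ s → s ≤ t → t ≤ 1 → ‖y t - y s‖ ≤
      YoungEuler.constG1star d h α C (YoungEuler.supAbs f) (YoungEuler.supGrad f) *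
        (t - s) ^ α :=
    fun s t hs hst ht => hy.norm_sub_le_constG1star hα hα' hC hf hf' hx hs hst ht
  have h2n : (0 : ℝ) < 2 ^ n := by positivity
  have hG : 0 ≤ YoungEuler.constG1star d h α C (YoungEuler.supAbs f) (YoungEuler.supGrad f) := by
    have := (norm_nonneg _).trans (hyH 0 1 le_rfl zero_le_one le_rfl)
    simpa using this
  set k := ⌊t * 2 ^ n⌋₊ with hk
  have hkt : (k : ℝ) ≤ t * 2 ^ n := Nat.floor_le (mul_nonneg ht.1 h2n.le)
  have hkt' : t * 2 ^ n < k + 1 := Nat.lt_floor_add_one _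
  have hk2 : k ≤ 2 ^ n := by
    have : (k : ℝ) ≤ 2 ^ n := hkt.trans (mul_le_of_le_one_left h2n.le ht.2)
    exact_mod_cast this
  have h1 := YoungEuler.grid_error hα hα' hC hf hf' hx hy hyH n hk2
  have hst : (k : ℝ) / 2 ^ n ≤ t := (div_le_iff₀ h2n).2 hkt
  have h2 := hyH ((k : ℝ) / 2 ^ n) t (by positivity) hst ht.2
  have h3 : t - (k : ℝ) / 2 ^ n ≤ 1 / 2 ^ n := by
    rw [sub_le_iff_le_add, ← add_div, le_div_iff₀ h2n]
    linarith
  -- Within a cell y moves by O(Δ^α), which is no worse than Δ^{2α−1} because 2α − 1 ≤ α and Δ ≤ 1;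
  -- this is the summand G₁* of G.
  have h4 : (t - (k : ℝ) / 2 ^ n) ^ α ≤ ((1 : ℝ) / 2 ^ n) ^ (2 * α - 1) :=
    (Real.rpow_le_rpow (sub_nonneg.2 hst) h3 (by linarith)).trans
      (Real.rpow_le_rpow_of_exponent_ge (by positivity)
        ((div_le_one h2n).2 (one_le_pow₀ one_le_two)) (by linarith))
  have h5 : ‖YoungEuler.eulerPath f x y₀ n t - y t‖ ≤
      ‖y ((k : ℝ) / 2 ^ n) - YoungEuler.eulerGrid f x y₀ n k‖ + ‖y t - y ((k : ℝ) / 2 ^ n)‖ := by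
    rw [norm_sub_rev (y ((k : ℝ) / 2 ^ n)), norm_sub_rev (y t)]
    exact norm_sub_le_norm_sub_add_norm_sub _ _ _
  refine h5.trans ((add_le_add h1 (h2.trans (mul_le_mul_of_nonneg_left h4 hG))).trans (le_of_eq ?_))
  unfold YoungEuler.constG
  ring
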